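/- Let $n\ge 1$ be an integer. Let $I\subseteq\mathbb{R}$ be an open interval (possibly unbounded). A function $f$ that is real-valued on $I$ is called $n$-monotone on $I$ if $f(A)\le f(B)$ for all $n\times n$ complex Hermitian matrices $A\le B$ whose spectra are contained in $I$ (for $I=(\alpha,\beta)$ this means $\alpha \mathbf 1<A\le B<\beta \mathbf 1$). It is called $n$-convex on $I$ if $f(tA+(1-t)B)\le t f(A)+(1-t)f(B)$ for all $t\in[0,1]$ and all $n\times n$ complex Hermitian matrices $A,B$ whose spectra are contained in $I$. Here $\le$ is the Loewner order ($X\le Y$ if and only if $Y-X$ is positive semidefinite), and $f(A)$ is defined by applying $f$ to the eigenvalues of $A$ (functional calculus). Let $-\infty\le a<c<b<d\le\infty$ and let $f:(a,d)\to\mathbb{R}$. If $f|_{(a,b)}$ and $f|_{(c,d)}$ are both $n$-monotone, then $f$ is $n$-monotone on $(a,d)$. If $f|_{(a,b)}$ and $f|_{(c,d)}$ are both $n$-convex, then $f$ is $n$-convex on $(a,d)$. -/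

import Mathlib

open scoped ComplexOrder

/-- A positive definite matrix is a Hermitian matrix all of whose eigenvalues are positive. -/
theorem posDef_iff_spectrum_pos {n : ℕ} {A : Matrix (Fin n) (Fin n) ℂ} (hA : A.IsHermitian) :
    A.PosDef ↔ ∀ x ∈ spectrum ℝ A, 0 < x := by
  rw [hA.posDef_iff_eigenvalues_pos, hA.spectrum_real_eq_range_eigenvalues]
  simp

/-- For a Hermitian matrix `A` and real `a`, `b`, the spectrum of `A` lies in the open interval
`(a, b)` if and only if `aI < A < bI` (both differences are positive definite). -/
theorem spectrum_subset_Ioo_iff {n : ℕ} {A : Matrix (Fin n) (Fin n) ℂ} (hA : A.IsHermitian)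
    (a b : ℝ) : spectrum ℝ A ⊆ Set.Ioo a b ↔
      (A - a • (1 : Matrix (Fin n) (Fin n) ℂ)).PosDef ∧
        (b • (1 : Matrix (Fin n) (Fin n) ℂ) - A).PosDef := by
  have hs : ∀ r : ℝ, (r • (1 : Matrix (Fin n) (Fin n) ℂ)).IsHermitian := by
    intro r
    have := Matrix.isHermitian_one (n := Fin n) (α := ℂ)
    simp [Matrix.IsHermitian, Matrix.conjTranspose_smul]
  rw [posDef_iff_spectrum_pos (hA.sub (hs a)), posDef_iff_spectrum_pos ((hs b).sub hA),
    ← Algebra.algebraMap_eq_smul_one, ← Algebra.algebraMap_eq_smul_one,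
    ← spectrum.sub_singleton_eq, ← spectrum.singleton_sub_eq]
  constructor
  · intro h
    constructor
    · rintro x ⟨y, hy, z, rfl, rfl⟩
      exact sub_pos.2 (h hy).1
    · rintro x ⟨z, rfl, y, hy, rfl⟩
      exact sub_pos.2 (h hy).2
  · rintro ⟨h1, h2⟩ y hy
    exact ⟨sub_pos.1 (h1 _ ⟨y, hy, a, rfl, rfl⟩), sub_pos.1 (h2 _ ⟨b, rfl, y, hy, rfl⟩)⟩

/-- The open interval `(a, b)` of real numbers; the endpoints may be infinite. -/
def openInterval (a b : EReal) : Set ℝ := {x : ℝ | a < (x : EReal) ∧ (x : EReal) < b}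

/-- `f` is `n`-monotone on `S`: for all Hermitian `n × n` complex matrices `A ≤ B` (Loewner order)
with spectra in `S` one has `f(A) ≤ f(B)`. Here `f(A)` is the functional calculus `cfc f A`, which
for Hermitian `A` depends only on the values of `f` on the (finite) spectrum of `A`.
For `S = (a, b)` the condition on the spectra says `aI < A` and `B < bI`. -/
def IsMatrixMonotoneOn (n : ℕ) (S : Set ℝ) (f : ℝ → ℝ) : Prop :=
  ∀ A B : Matrix (Fin n) (Fin n) ℂ, A.IsHermitian → B.IsHermitian →
    spectrum ℝ A ⊆ S → spectrum ℝ B ⊆ S →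
    (B - A).PosSemidef → (cfc f B - cfc f A).PosSemidef

/-- `f` is `n`-convex on the interval `S`: for all Hermitian `n × n` complex matrices `A`, `B`
with spectra in `S` and all `t ∈ [0, 1]` one has
`f(tA + (1 - t)B) ≤ t f(A) + (1 - t) f(B)` in the Loewner order. -/
def IsMatrixConvexOn (n : ℕ) (S : Set ℝ) (f : ℝ → ℝ) : Prop :=
  ∀ A B : Matrix (Fin n) (Fin n) ℂ, A.IsHermitian → B.IsHermitian →
    spectrum ℝ A ⊆ S → spectrum ℝ B ⊆ S →
    ∀ t : ℝ, 0 ≤ t → t ≤ 1 →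
      (t • cfc f A + (1 - t) • cfc f B - cfc f (t • A + (1 - t) • B)).PosSemidef

/-! The point is that both properties are local once `f` is smooth. Writing f[·] for divided
differences, a smooth `f` is n-monotone on an interval iff (f q²)^(2n-1) ≥ 0 there for every real
polynomial q of degree < n, and n-convex iff (f q²)^(2n) ≥ 0
(`isMatrixMonotoneOn_iff_squareDerivNonneg`, `isMatrixConvexOn_iff_squareDerivNonneg`). A pointwise
condition holding on two overlapping intervals holds on their union.

The link with matrices is an exact first order expansion at a diagonal matrix
(`reForm_sub_eq_sum_krausTerm`): the linear part is the Hadamard product with the Loewner matrix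
f[γ_i, γ_k], and the remainder is a sum of forms built from (α - γ_i)(α - γ_k) f[α, γ_i, γ_k].
Monotonicity thus amounts to positivity of Loewner matrices, convexity to positivity of the Kraus
matrices f[α, γ_i, γ_k].

The link with derivatives is a confluent divided difference identity. With weights w_i = q(γ_i) /
∏_{k ≠ i} (γ_i - γ_k), the sum ∑ w_i w_k f[γ_i, γ_k] is the divided difference of f q² over the
nodes γ_i, each taken twice, and ∑ w_i w_k f[α, γ_i, γ_k] is the one with α added. The mean value
theorem turns these into derivatives of order 2n-1 and 2n, and every real vector is a weight vector
of some q.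

A continuous `f` is handled by mollification, which preserves both properties on slightly smaller
intervals. Continuity is automatic for convex functions, and for n-monotone ones when n ≥ 2, by the
2 × 2 Loewner determinant. For n = 1 monotone functions are glued directly. -/

/-! ### Real quadratic forms of complex matrices -/

section ReForm

open Matrix Finset

variable {n : ℕ}

/-- Real part of the Hermitian form of a matrix. -/
noncomputable def reForm (M : Matrix (Fin n) (Fin n) ℂ) (w : Fin n → ℂ) : ℝ :=
  (star w ⬝ᵥ M *ᵥ w).re

theorem reForm_add (M N : Matrix (Fin n) (Fin n) ℂ) (w : Fin n → ℂ) :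
    reForm (M + N) w = reForm M w + reForm N w := by
  simp [reForm, add_mulVec, dotProduct_add]

theorem reForm_sub (M N : Matrix (Fin n) (Fin n) ℂ) (w : Fin n → ℂ) :
    reForm (M - N) w = reForm M w - reForm N w := by
  simp [reForm, sub_mulVec, dotProduct_sub]

theorem reForm_smul (t : ℝ) (M : Matrix (Fin n) (Fin n) ℂ) (w : Fin n → ℂ) :
    reForm (t • M) w = t * reForm M w := by
  simp [reForm, smul_mulVec, dotProduct_smul]

theorem reForm_eq_sum (M : Matrix (Fin n) (Fin n) ℂ) (w : Fin n → ℂ) :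
    reForm M w = ∑ i, ∑ k, (star (w i) * M i k * w k).re := by
  simp [reForm, dotProduct, mulVec, Finset.mul_sum, mul_assoc]

theorem reForm_conj (M U : Matrix (Fin n) (Fin n) ℂ) (w : Fin n → ℂ) :
    reForm (U * M * star U) w = reForm M (star U *ᵥ w) := by
  simp only [reForm]
  rw [star_mulVec, ← dotProduct_mulVec, mulVec_mulVec, mulVec_mulVec, star_eq_conjTranspose,
    conjTranspose_conjTranspose, mul_assoc]

theorem reForm_diagonal (d : Fin n → ℝ) (w : Fin n → ℂ) :
    reForm (diagonal fun i => (d i : ℂ)) w = ∑ i, d i * ‖w i‖ ^ 2 := by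
  simp only [reForm, dotProduct, mulVec_diagonal, Complex.re_sum]
  refine Finset.sum_congr rfl fun i _ => ?_
  rw [← Complex.normSq_eq_norm_sq, Complex.normSq_apply]
  simp
  ring

/-- The form of a Hermitian matrix is real, so its real part loses nothing. Loewner inequalities
become scalar inequalities for each fixed vector, which can be summed, integrated and passed to the
limit. -/
theorem posSemidef_iff_reForm {M : Matrix (Fin n) (Fin n) ℂ} (hM : M.IsHermitian) :
    M.PosSemidef ↔ ∀ w, 0 ≤ reForm M w := by
  rw [posSemidef_iff_dotProduct_mulVec]
  refine ⟨fun h w => (Complex.le_def.1 (h.2 w)).1, fun h => ⟨hM, fun w => ?_⟩⟩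
  refine Complex.le_def.2 ⟨h w, ?_⟩
  exact (hM.im_star_dotProduct_mulVec_self w).symm

theorem posDef_iff_reForm {M : Matrix (Fin n) (Fin n) ℂ} (hM : M.IsHermitian) :
    M.PosDef ↔ ∀ w, w ≠ 0 → 0 < reForm M w := by
  rw [posDef_iff_dotProduct_mulVec]
  refine ⟨fun h w hw => (Complex.lt_def.1 (h.2 hw)).1, fun h => ⟨hM, fun w hw => ?_⟩⟩
  refine Complex.lt_def.2 ⟨h w hw, ?_⟩
  exact (hM.im_star_dotProduct_mulVec_self w).symm

end ReForm

/-! ### Hermitian matrices and their functional calculus in an eigenbasis -/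

section Decomposition

open Matrix Finset

variable {n : ℕ}

/-- The real algebra of matrices that are diagonal in the basis of the columns of `U`. -/
noncomputable def conjDiagonal (U : unitaryGroup (Fin n) ℂ) : (Fin n → ℝ) →ₐ[ℝ] Matrix (Fin n) (Fin n) ℂ :=
  AlgHom.ofLinearMap
    { toFun := fun d => (U : Matrix (Fin n) (Fin n) ℂ) * diagonal (fun i => (d i : ℂ)) * star (U : Matrix (Fin n) (Fin n) ℂ)
      map_add' := fun d e => by
        simp [← diagonal_add, mul_add, add_mul]
      map_smul' := fun t d => by
        have : (diagonal fun i => (((t • d) i : ℝ) : ℂ)) = t • diagonal fun i => (d i : ℂ) := by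
          ext i j; by_cases h : i = j <;> simp [h, diagonal]
        simp only [this, Matrix.mul_smul, Matrix.smul_mul, RingHom.id_apply] }
    (by simp)
    (fun d e => by
      have h : star (U : Matrix (Fin n) (Fin n) ℂ) * U = 1 := Unitary.coe_star_mul_self U
      have h2 : (diagonal fun i => (((d * e) i : ℝ) : ℂ)) =
          (diagonal fun i => (d i : ℂ)) * diagonal fun i => (e i : ℂ) := by simp
      simp only [LinearMap.coe_mk, AddHom.coe_mk]
      rw [h2]
      simp only [Matrix.mul_assoc]
      rw [← Matrix.mul_assoc (star _) (U : Matrix (Fin n) (Fin n) ℂ), h, Matrix.one_mul])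

theorem conjDiagonal_apply (U : unitaryGroup (Fin n) ℂ) (d : Fin n → ℝ) :
    conjDiagonal U d = (U : Matrix (Fin n) (Fin n) ℂ) * diagonal (fun i => (d i : ℂ)) * star (U : Matrix (Fin n) (Fin n) ℂ) := rfl

theorem isHermitian_conjDiagonal (U : unitaryGroup (Fin n) ℂ) (d : Fin n → ℝ) :
    (conjDiagonal U d).IsHermitian := by
  rw [conjDiagonal_apply, star_eq_conjTranspose]
  apply isHermitian_mul_mul_conjTranspose
  simp [IsHermitian, diagonal_conjTranspose, Pi.star_def]

theorem spectrum_conjDiagonal (U : unitaryGroup (Fin n) ℂ) (d : Fin n → ℝ) :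
    spectrum ℝ (conjDiagonal U d) = Set.range d := by
  rw [conjDiagonal_apply]
  ext x
  rw [← spectrum.algebraMap_mem_iff ℂ, Unitary.spectrum_star_right_conjugate, spectrum_diagonal]
  simp

/-- On the finite spectrum `f` agrees with a Lagrange interpolant, and polynomials commute with the
algebra homomorphism `conjDiagonal U`. No continuity of `f` is needed. -/
theorem cfc_conjDiagonal (f : ℝ → ℝ) (U : unitaryGroup (Fin n) ℂ) (d : Fin n → ℝ) :
    cfc f (conjDiagonal U d) = conjDiagonal U (f ∘ d) := by
  set S : Finset ℝ := univ.image d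
  set p : Polynomial ℝ := Lagrange.interpolate S id f
  have hp : ∀ i, p.eval (d i) = f (d i) := fun i =>
    Lagrange.eval_interpolate_at_node (s := S) (v := id) f (Set.injOn_id _)
      (Finset.mem_image_of_mem d (mem_univ i))
  have h1 : cfc f (conjDiagonal U d) = cfc p.eval (conjDiagonal U d) := by
    refine cfc_congr ?_
    rw [spectrum_conjDiagonal]
    rintro _ ⟨i, rfl⟩
    exact (hp i).symm
  have hs : IsSelfAdjoint (conjDiagonal U d) := isHermitian_conjDiagonal U d
  rw [h1, cfc_polynomial p _ hs, Polynomial.aeval_algHom_apply]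
  congr 1
  ext i
  rw [Function.comp_apply, ← hp]
  exact (Polynomial.aeval_algHom_apply (Pi.evalAlgHom ℝ (fun _ : Fin n => ℝ) i) d p).symm

theorem reForm_conjDiagonal (U : unitaryGroup (Fin n) ℂ) (d : Fin n → ℝ) (w : Fin n → ℂ) :
    reForm (conjDiagonal U d) w = ∑ i, d i * ‖(star (U : Matrix (Fin n) (Fin n) ℂ) *ᵥ w) i‖ ^ 2 := by
  rw [conjDiagonal_apply, reForm_conj, reForm_diagonal]

theorem exists_conjDiagonal {A : Matrix (Fin n) (Fin n) ℂ} (hA : A.IsHermitian) :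
    ∃ (U : unitaryGroup (Fin n) ℂ) (d : Fin n → ℝ), A = conjDiagonal U d :=
  ⟨hA.eigenvectorUnitary, hA.eigenvalues, hA.spectral_theorem⟩

theorem isHermitian_cfc (f : ℝ → ℝ) (A : Matrix (Fin n) (Fin n) ℂ) : (cfc f A).IsHermitian :=
  cfc_predicate f A

end Decomposition

/-! ### Spectra under convex combinations and small perturbations -/

section Spectrum

open Matrix Finset

variable {n : ℕ}

theorem isHermitian_real_smul_one (r : ℝ) :
    (r • (1 : Matrix (Fin n) (Fin n) ℂ)).IsHermitian := by
  have := isHermitian_one (n := Fin n) (α := ℂ)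
  simp [IsHermitian, conjTranspose_smul]

/-- The spectrum lies in an open interval iff the Hermitian form is pinched accordingly. -/
theorem spectrum_subset_Ioo_iff_reForm {A : Matrix (Fin n) (Fin n) ℂ} (hA : A.IsHermitian)
    (l u : ℝ) : spectrum ℝ A ⊆ Set.Ioo l u ↔
      ∀ w, w ≠ 0 → l * reForm 1 w < reForm A w ∧ reForm A w < u * reForm 1 w := by
  rw [spectrum_subset_Ioo_iff hA, posDef_iff_reForm (hA.sub (isHermitian_real_smul_one l)),
    posDef_iff_reForm ((isHermitian_real_smul_one u).sub hA)]
  simp only [reForm_sub, reForm_smul, sub_pos]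
  exact ⟨fun h w hw => ⟨h.1 w hw, h.2 w hw⟩, fun h => ⟨fun w hw => (h w hw).1, fun w hw => (h w hw).2⟩⟩

theorem spectrum_convexComb_subset_Ioo {A B : Matrix (Fin n) (Fin n) ℂ} (hA : A.IsHermitian)
    (hB : B.IsHermitian) {l u : ℝ} (hAs : spectrum ℝ A ⊆ Set.Ioo l u)
    (hBs : spectrum ℝ B ⊆ Set.Ioo l u) {t : ℝ} (h0 : 0 ≤ t) (h1 : t ≤ 1) :
    spectrum ℝ (t • A + (1 - t) • B) ⊆ Set.Ioo l u := by
  rw [spectrum_subset_Ioo_iff_reForm hA] at hAs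
  rw [spectrum_subset_Ioo_iff_reForm hB] at hBs
  have ht : (t • A).IsHermitian := by
    simp [IsHermitian, conjTranspose_smul, hA.eq]
  have ht' : ((1 - t) • B).IsHermitian := by
    simp [IsHermitian, conjTranspose_smul, hB.eq]
  rw [spectrum_subset_Ioo_iff_reForm (ht.add ht')]
  intro w hw
  have a := hAs w hw
  have b := hBs w hw
  rw [reForm_add, reForm_smul, reForm_smul]
  rcases h0.eq_or_lt with rfl | h0
  · simpa using b
  · constructor <;> nlinarith

theorem isHermitian_real_smul {A : Matrix (Fin n) (Fin n) ℂ} (hA : A.IsHermitian) (t : ℝ) :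
    (t • A).IsHermitian := by
  simp [IsHermitian, conjTranspose_smul, hA.eq]

/-- A small Hermitian perturbation keeps the spectrum inside an open interval. -/
theorem exists_pos_spectrum_add_smul_subset {A D : Matrix (Fin n) (Fin n) ℂ} (hA : A.IsHermitian)
    (hD : D.IsHermitian) {l u : ℝ} (hAs : spectrum ℝ A ⊆ Set.Ioo l u) :
    ∃ η > 0, ∀ s : ℝ, |s| ≤ η → spectrum ℝ (A + s • D) ⊆ Set.Ioo l u := by
  obtain ⟨U, d, rfl⟩ := exists_conjDiagonal hA
  obtain ⟨W, e, rfl⟩ := exists_conjDiagonal hD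
  rw [spectrum_conjDiagonal] at hAs
  have hd : ∀ i, l < d i ∧ d i < u := fun i => hAs ⟨i, rfl⟩
  obtain ⟨δ, hδ, hδd⟩ : ∃ δ > 0, ∀ i, l + δ ≤ d i ∧ d i + δ ≤ u := by
    by_cases hn : IsEmpty (Fin n)
    · exact ⟨1, one_pos, fun i => (hn.false i).elim⟩
    · rw [not_isEmpty_iff] at hn
      refine ⟨univ.inf' univ_nonempty fun i => min (d i - l) (u - d i), ?_, fun i => ?_⟩
      · rw [gt_iff_lt, Finset.lt_inf'_iff]
        intro i _
        exact lt_min (sub_pos.2 (hd i).1) (sub_pos.2 (hd i).2)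
      · have := Finset.inf'_le (fun i => min (d i - l) (u - d i)) (mem_univ i)
        have h1 := min_le_left (d i - l) (u - d i)
        have h2 := min_le_right (d i - l) (u - d i)
        constructor <;> linarith
  -- A bound for the eigenvalues of the perturbation; the summand 1 keeps it positive, so that it
  -- can be divided by.
  set m : ℝ := 1 + ∑ i, |e i|
  have hm : 0 < m := by positivity
  have hme : ∀ i, |e i| ≤ m := fun i => by
    have := Finset.single_le_sum (f := fun i => |e i|) (fun i _ => abs_nonneg _) (mem_univ i)
    simp only [m]; linarith
  have hone : ∀ (V : unitaryGroup (Fin n) ℂ) w, ∑ i, ‖(star (V : Matrix (Fin n) (Fin n) ℂ) *ᵥ w) i‖ ^ 2 =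
      reForm 1 w := by
    intro V w
    have := reForm_conjDiagonal V 1 w
    rw [map_one] at this
    simpa using this.symm
  have hform : ∀ (V : unitaryGroup (Fin n) ℂ) (a : Fin n → ℝ) (lo : ℝ) w, (∀ i, lo ≤ a i) →
      lo * reForm 1 w ≤ reForm (conjDiagonal V a) w := by
    intro V a lo w h
    rw [reForm_conjDiagonal, ← hone V, Finset.mul_sum]
    exact Finset.sum_le_sum fun i _ => mul_le_mul_of_nonneg_right (h i) (by positivity)
  have hform' : ∀ (V : unitaryGroup (Fin n) ℂ) (a : Fin n → ℝ) (up : ℝ) w, (∀ i, a i ≤ up) →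
      reForm (conjDiagonal V a) w ≤ up * reForm 1 w := by
    intro V a lo w h
    rw [reForm_conjDiagonal, ← hone V, Finset.mul_sum]
    exact Finset.sum_le_sum fun i _ => mul_le_mul_of_nonneg_right (h i) (by positivity)
  -- The perturbation moves the form by at most half of the margin `δ`, so the bounds stay strict.
  refine ⟨δ / (2 * m), by positivity, fun s hs => ?_⟩
  have hsm : |s| * m ≤ δ / 2 := by
    calc |s| * m ≤ δ / (2 * m) * m := by gcongr
      _ = δ / 2 := by field_simp
  rw [spectrum_subset_Ioo_iff_reForm
    ((isHermitian_conjDiagonal U d).add (isHermitian_real_smul hD s))]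
  intro w hw
  have hw1 : 0 < reForm 1 w := (posDef_iff_reForm isHermitian_one).1 PosDef.one w hw
  have hse : ∀ i, |s * e i| ≤ δ / 2 := fun i => by
    rw [abs_mul]
    exact (mul_le_mul_of_nonneg_left (hme i) (abs_nonneg s)).trans hsm
  have hsD : s • conjDiagonal W e = conjDiagonal W (s • e) := by rw [map_smul]
  rw [reForm_add, hsD]
  have a1 := hform U d (l + δ) w fun i => (hδd i).1
  have a2 := hform' U d (u - δ) w fun i => by linarith [(hδd i).2]
  have b1 := hform W (s • e) (-(δ / 2)) w fun i => (abs_le.1 (hse i)).1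
  have b2 := hform' W (s • e) (δ / 2) w fun i => (abs_le.1 (hse i)).2
  constructor <;> nlinarith

end Spectrum

/-! ### First order expansion of matrix functions and its exact remainder -/

section Loewner

open Matrix Finset

variable {n : ℕ}

/-- The Loewner matrix of `f` at the points `γ`, with the derivative where points coincide. -/
noncomputable def loewner (f : ℝ → ℝ) (γ : Fin n → ℝ) : Matrix (Fin n) (Fin n) ℂ :=
  Matrix.of fun i k => ((dslope f (γ i) (γ k) : ℝ) : ℂ)

/-- The remainder of the first order expansion of `f` between the points `x`, `y`,
evaluated at `α`; it is `(α - x) (α - y)` times the second divided difference. -/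
noncomputable def krausTerm (f : ℝ → ℝ) (α x y : ℝ) : ℝ :=
  f α - f y - dslope f x y * (α - y)

/-- Every entry involved is a sum over j of V_ij conj(V_kj) times a scalar: unitarity writes the
identity matrix, hence every diagonal matrix, in this form. Collecting the scalars gives
`krausTerm`. -/
theorem sub_diagonal_sub_hadamard_apply (f : ℝ → ℝ) (V : unitaryGroup (Fin n) ℂ)
    (α γ : Fin n → ℝ) (i k : Fin n) :
    (conjDiagonal V (f ∘ α) - diagonal (fun i => (f (γ i) : ℂ)) -
      loewner f γ ⊙ (conjDiagonal V α - diagonal fun i => (γ i : ℂ))) i k =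
    ∑ j, (V : Matrix (Fin n) (Fin n) ℂ) i j * star ((V : Matrix (Fin n) (Fin n) ℂ) k j) *
      (krausTerm f (α j) (γ i) (γ k) : ℂ) := by
  have hV : ∀ e : Fin n → ℝ, conjDiagonal V e i k =
      ∑ j, (V : Matrix (Fin n) (Fin n) ℂ) i j * star ((V : Matrix (Fin n) (Fin n) ℂ) k j) * (e j : ℂ) := by
    intro e
    rw [conjDiagonal_apply, Matrix.mul_apply]
    refine Finset.sum_congr rfl fun j _ => ?_
    rw [mul_diagonal, star_apply]
    ring
  have h1 : ∑ j, (V : Matrix (Fin n) (Fin n) ℂ) i j * star ((V : Matrix (Fin n) (Fin n) ℂ) k j) =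
      (1 : Matrix (Fin n) (Fin n) ℂ) i k := by
    have := hV 1
    rw [map_one] at this
    simp [this]
  -- The diagonal value is taken at the column index k, matching the asymmetric form of `krausTerm`,
  -- which expands around its last argument.
  have hd : ∀ e : Fin n → ℝ, diagonal (fun i => (e i : ℂ)) i k =
      (e k : ℂ) * (1 : Matrix (Fin n) (Fin n) ℂ) i k := by
    intro e
    by_cases h : i = k
    · subst h; simp
    · simp [h]
  have hd1 := hd γ
  have hd2 := hd fun i => f (γ i)
  simp only [Matrix.sub_apply, hadamard_apply]
  rw [hd1, hd2, ← h1, hV, hV]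
  simp only [krausTerm, loewner, of_apply, Function.comp_apply]
  simp only [Finset.mul_sum, ← Finset.sum_sub_distrib]
  refine Finset.sum_congr rfl fun j _ => ?_
  push_cast
  ring

/-- Exact first order expansion of a matrix function at a diagonal matrix. -/
theorem reForm_sub_eq_sum_krausTerm (f : ℝ → ℝ) (V : unitaryGroup (Fin n) ℂ)
    (α γ : Fin n → ℝ) (w : Fin n → ℂ) :
    reForm (conjDiagonal V (f ∘ α)) w - reForm (diagonal (fun i => (f (γ i) : ℂ))) w -
      reForm (loewner f γ ⊙ (conjDiagonal V α - diagonal fun i => (γ i : ℂ))) w =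
    ∑ j, ∑ i, ∑ k, (star (w i) * (V : Matrix (Fin n) (Fin n) ℂ) i j *
      star (star (w k) * (V : Matrix (Fin n) (Fin n) ℂ) k j)).re *
        krausTerm f (α j) (γ i) (γ k) := by
  rw [← reForm_sub, ← reForm_sub, reForm_eq_sum]
  simp only [sub_diagonal_sub_hadamard_apply]
  simp only [Finset.mul_sum, Finset.sum_mul, Complex.re_sum]
  have : ∀ i k j, (star (w i) * ((V : Matrix (Fin n) (Fin n) ℂ) i j *
      star ((V : Matrix (Fin n) (Fin n) ℂ) k j) * (krausTerm f (α j) (γ i) (γ k) : ℂ)) * w k).re =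
      (star (w i) * (V : Matrix (Fin n) (Fin n) ℂ) i j *
      star (star (w k) * (V : Matrix (Fin n) (Fin n) ℂ) k j)).re *
        krausTerm f (α j) (γ i) (γ k) := by
    intro i k j
    rw [← Complex.re_mul_ofReal]
    congr 1
    simp only [star_mul, star_star]
    ring
  simp only [this]
  conv_rhs => rw [Finset.sum_comm]
  refine Finset.sum_congr rfl fun i _ => ?_
  rw [Finset.sum_comm]

/-- The entries of the difference in the two bases. -/
theorem sub_diagonal_mul_apply (V : unitaryGroup (Fin n) ℂ) (α γ : Fin n → ℝ) (i j : Fin n) :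
    ((conjDiagonal V α - diagonal fun i => (γ i : ℂ)) * (V : Matrix (Fin n) (Fin n) ℂ)) i j =
      (V : Matrix (Fin n) (Fin n) ℂ) i j * ((α j : ℂ) - γ i) := by
  have : conjDiagonal V α * (V : Matrix (Fin n) (Fin n) ℂ) =
      (V : Matrix (Fin n) (Fin n) ℂ) * diagonal fun i => (α i : ℂ) := by
    rw [conjDiagonal_apply, Matrix.mul_assoc, Unitary.coe_star_mul_self V, Matrix.mul_one]
  rw [sub_mul, this, Matrix.sub_apply, mul_diagonal, diagonal_mul]
  ring

theorem norm_mul_apply_le (D : Matrix (Fin n) (Fin n) ℂ) (V : unitaryGroup (Fin n) ℂ) (i j : Fin n) :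
    ‖(D * (V : Matrix (Fin n) (Fin n) ℂ)) i j‖ ≤ ∑ i, ∑ k, ‖D i k‖ := by
  rw [Matrix.mul_apply]
  calc ‖∑ k, D i k * (V : Matrix (Fin n) (Fin n) ℂ) k j‖ ≤ ∑ k, ‖D i k‖ := by
        refine norm_sum_le_of_le _ fun k _ => ?_
        rw [norm_mul]
        exact mul_le_of_le_one_right (norm_nonneg _) (entry_norm_bound_of_unitary V.2 _ _)
    _ ≤ _ := Finset.single_le_sum (f := fun i => ∑ k, ‖D i k‖)
        (fun i _ => Finset.sum_nonneg fun k _ => norm_nonneg _) (mem_univ i)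

/-- First order expansion of a matrix function at a diagonal matrix with quadratic remainder. -/
theorem abs_reForm_sub_le {f : ℝ → ℝ} {L : ℝ} (hL : 0 ≤ L) (V : unitaryGroup (Fin n) ℂ)
    (α γ : Fin n → ℝ)
    (hK : ∀ i j k, |krausTerm f (α j) (γ i) (γ k)| ≤ L * (|α j - γ i| * |α j - γ k|))
    (w : Fin n → ℂ) {D : Matrix (Fin n) (Fin n) ℂ}
    (hD : conjDiagonal V α - diagonal (fun i => (γ i : ℂ)) = D) :
    |reForm (conjDiagonal V (f ∘ α)) w - reForm (diagonal (fun i => (f (γ i) : ℂ))) w -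
      reForm (loewner f γ ⊙ D) w| ≤
    L * n * ((∑ i, ‖w i‖) * ∑ i, ∑ k, ‖D i k‖) ^ 2 := by
  subst hD
  set D := conjDiagonal V α - diagonal (fun i => (γ i : ℂ)) with hD
  rw [hD, reForm_sub_eq_sum_krausTerm]
  -- V_ij (α_j - γ_i) is an entry of D V, so each of the two factors in the bound on `krausTerm` is
  -- absorbed by an entry of V. The error is quadratic in D, whatever the gaps between eigenvalues.
  have hb : ∀ i j, ‖(V : Matrix (Fin n) (Fin n) ℂ) i j‖ * |α j - γ i| ≤ ∑ i, ∑ k, ‖D i k‖ := by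
    intro i j
    have h := norm_mul_apply_le D V i j
    rw [hD, sub_diagonal_mul_apply, norm_mul] at h
    refine le_trans (le_of_eq ?_) h
    rw [← Complex.ofReal_sub, Complex.norm_real, Real.norm_eq_abs]
  calc _ ≤ ∑ _j : Fin n, L * ((∑ i, ‖w i‖) * ∑ i, ∑ k, ‖D i k‖) ^ 2 := by
        refine (Finset.abs_sum_le_sum_abs _ _).trans (Finset.sum_le_sum fun j _ => ?_)
        have : L * ((∑ i, ‖w i‖) * ∑ i, ∑ k, ‖D i k‖) ^ 2 =
            ∑ i, ∑ k, L * ((‖w i‖ * ∑ i, ∑ k, ‖D i k‖) * (‖w k‖ * ∑ i, ∑ k, ‖D i k‖)) := by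
          simp only [← Finset.mul_sum, ← Finset.sum_mul]
          ring
        rw [this]
        refine (Finset.abs_sum_le_sum_abs _ _).trans (Finset.sum_le_sum fun i _ => ?_)
        refine (Finset.abs_sum_le_sum_abs _ _).trans (Finset.sum_le_sum fun k _ => ?_)
        rw [abs_mul]
        have h1 := Complex.abs_re_le_norm (star (w i) * (V : Matrix (Fin n) (Fin n) ℂ) i j *
          star (star (w k) * (V : Matrix (Fin n) (Fin n) ℂ) k j))
        simp only [norm_mul, norm_star] at h1
        calc _ ≤ (‖w i‖ * ‖(V : Matrix (Fin n) (Fin n) ℂ) i j‖ * (‖w k‖ * ‖(V : Matrix (Fin n) (Fin n) ℂ) k j‖)) *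
              (L * (|α j - γ i| * |α j - γ k|)) :=
              mul_le_mul h1 (hK i j k) (abs_nonneg _) (by positivity)
          _ = L * ((‖w i‖ * (‖(V : Matrix (Fin n) (Fin n) ℂ) i j‖ * |α j - γ i|)) *
              (‖w k‖ * (‖(V : Matrix (Fin n) (Fin n) ℂ) k j‖ * |α j - γ k|))) := by ring
          _ ≤ _ := by gcongr <;> exact hb _ _
    _ = _ := by
      rw [Finset.sum_const, Finset.card_univ, Fintype.card_fin, nsmul_eq_mul]; ring

end Loewner

/-! ### Divided differences of first order and the Kraus remainder -/

section Dslope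

open Set Filter Topology intervalIntegral

theorem dslope_symm (f : ℝ → ℝ) (x y : ℝ) : dslope f x y = dslope f y x := by
  rcases eq_or_ne x y with rfl | h
  · rfl
  · rw [dslope_of_ne _ h.symm, dslope_of_ne _ h, slope_comm]

theorem dslope_eq_div {f : ℝ → ℝ} {x y : ℝ} (h : x ≠ y) : dslope f x y = (f y - f x) / (y - x) := by
  rw [dslope_of_ne _ h.symm, slope_def_field]

/-- The integral formula covers coinciding points too, and yields both joint continuity and
Lipschitz bounds. -/
theorem dslope_eq_integral {f : ℝ → ℝ} (hf : ContDiff ℝ 1 f) (x y : ℝ) :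
    dslope f x y = ∫ s in (0 : ℝ)..1, deriv f (x + s * (y - x)) := by
  rcases eq_or_ne x y with rfl | h
  · simp
  · have hd : ∀ s ∈ uIcc (0 : ℝ) 1, HasDerivAt (fun s => f (x + s * (y - x)) / (y - x))
        (deriv f (x + s * (y - x))) s := by
      intro s _
      have h1 : HasDerivAt (fun s : ℝ => x + s * (y - x)) (y - x) s := by
        simpa using ((hasDerivAt_id s).mul_const (y - x)).const_add x
      have h2 := ((hf.differentiable one_ne_zero (x + s * (y - x))).hasDerivAt.comp s h1).div_const
        (y - x)
      have hne : y - x ≠ 0 := sub_ne_zero.2 h.symm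
      simpa [hne] using h2
    rw [integral_eq_sub_of_hasDerivAt hd, dslope_eq_div h]
    · simp [sub_div]
    · apply Continuous.intervalIntegrable
      exact (hf.continuous_deriv le_rfl).comp (by fun_prop)

theorem continuous_dslope {f : ℝ → ℝ} (hf : ContDiff ℝ 1 f) :
    Continuous fun p : ℝ × ℝ => dslope f p.1 p.2 := by
  simp only [dslope_eq_integral hf]
  apply continuous_parametric_intervalIntegral_of_continuous'
  exact (hf.continuous_deriv le_rfl).comp (by fun_prop)

/-- The remainder equals (f[y, α] - f[y, x]) (α - y), and the integral formula bounds the bracket by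
the Lipschitz constant of the derivative. -/
theorem abs_krausTerm_le {f : ℝ → ℝ} (hf : ContDiff ℝ 1 f) {L l u : ℝ}
    (hL : ∀ x ∈ Icc l u, ∀ y ∈ Icc l u, |deriv f x - deriv f y| ≤ L * |x - y|)
    {α x y : ℝ} (hα : α ∈ Icc l u) (hx : x ∈ Icc l u) (hy : y ∈ Icc l u) (hL0 : 0 ≤ L) :
    |krausTerm f α x y| ≤ L * (|α - x| * |α - y|) := by
  have h1 : krausTerm f α x y = (dslope f y α - dslope f y x) * (α - y) := by
    have := sub_smul_dslope f y α
    rw [smul_eq_mul] at this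
    rw [krausTerm, dslope_symm f x y]
    linarith
  have hc : ∀ z, IntervalIntegrable (fun s => deriv f (y + s * (z - y))) MeasureTheory.volume 0 1 := by
    intro z
    apply Continuous.intervalIntegrable
    exact (hf.continuous_deriv le_rfl).comp (by fun_prop)
  have h2 : |dslope f y α - dslope f y x| ≤ L * |α - x| := by
    rw [dslope_eq_integral hf, dslope_eq_integral hf, ← integral_sub (hc α) (hc x)]
    have := norm_integral_le_of_norm_le_const (a := (0 : ℝ)) (b := 1) (C := L * |α - x|)
      (f := fun s => deriv f (y + s * (α - y)) - deriv f (y + s * (x - y))) ?_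
    · simpa using this
    · intro s hs
      rw [uIoc_of_le zero_le_one] at hs
      have hm : ∀ z ∈ Icc l u, y + s * (z - y) ∈ Icc l u := by
        intro z hz
        have := (convex_Icc l u) hy hz (sub_nonneg.2 hs.2) hs.1.le (by ring)
        convert this using 1
        simp only [smul_eq_mul]; ring
      rw [Real.norm_eq_abs]
      refine (hL _ (hm α hα) _ (hm x hx)).trans ?_
      have : y + s * (α - y) - (y + s * (x - y)) = s * (α - x) := by ring
      rw [this, abs_mul, abs_of_pos hs.1]
      gcongr
      exact mul_le_of_le_one_left (abs_nonneg _) hs.2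
  rw [h1, abs_mul, ← mul_assoc]
  gcongr

theorem continuous_krausTerm {f : ℝ → ℝ} (hf : ContDiff ℝ 1 f) (α : ℝ) :
    Continuous fun p : ℝ × ℝ => krausTerm f α p.1 p.2 := by
  have := continuous_dslope hf
  have := hf.continuous
  unfold krausTerm
  fun_prop

end Dslope

/-! ### Algebra of divided differences -/

section DivDiff

open Finset Polynomial

/-- Divided difference of `g` over the set of nodes `S`. -/
noncomputable def divDiff (S : Finset ℝ) (g : ℝ → ℝ) : ℝ :=
  ∑ x ∈ S, g x / ∏ y ∈ S.erase x, (x - y)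

theorem divDiff_polynomial {S : Finset ℝ} {p : ℝ[X]} (hp : p.degree < #S) :
    divDiff S p.eval = p.coeff (#S - 1) :=
  (Lagrange.coeff_eq_sum (s := S) (v := id) (Set.injOn_id _) hp).symm

/-- This is the partial fraction expansion of r / ∏ (x - y): Lagrange interpolation of r at the
nodes of T, evaluated at x and divided by the nodal polynomial. -/
theorem sum_div_sub {T : Finset ℝ} {r : ℝ[X]} (hr : r.degree < #T) {x : ℝ} (hx : x ∉ T) :
    ∑ y ∈ T, r.eval y / (∏ z ∈ T.erase y, (y - z)) / (x - y) = r.eval x / ∏ y ∈ T, (x - y) := by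
  have hx' : ∀ i ∈ T, x ≠ id i := fun i hi h => hx (h ▸ hi)
  have h0 : ∏ y ∈ T, (x - y) ≠ 0 := Finset.prod_ne_zero_iff.2 fun i hi => sub_ne_zero.2 (hx' i hi)
  have h1 := Lagrange.eq_interpolate (s := T) (v := id) (Set.injOn_id _) hr
  have h2 := Lagrange.eval_interpolate_not_at_node (s := T) (v := id) (fun i => r.eval (id i)) hx'
  rw [← h1, Lagrange.eval_nodal] at h2
  rw [h2]
  simp only [id]
  rw [mul_div_cancel_left₀ _ h0]
  refine Finset.sum_congr rfl fun y _ => ?_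
  simp only [Lagrange.nodalWeight, id, Finset.prod_inv_distrib]
  rw [div_div, div_eq_mul_inv, mul_inv]
  ring

theorem prod_erase_union_left {S T : Finset ℝ} (h : Disjoint S T) {x : ℝ} (hx : x ∈ S) :
    ∏ y ∈ (S ∪ T).erase x, (x - y) = (∏ y ∈ S.erase x, (x - y)) * ∏ y ∈ T, (x - y) := by
  rw [Finset.erase_union_distrib, Finset.erase_eq_of_notMem (Finset.disjoint_left.1 h hx),
    Finset.prod_union (h.mono_left (Finset.erase_subset _ _))]

/-- Divided differences of a product over the union of two node sets. -/
theorem divDiff_union {S T : Finset ℝ} (h : Disjoint S T) {q r : ℝ[X]} (hq : q.degree < #S)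
    (hr : r.degree < #T) (f : ℝ → ℝ) :
    divDiff (S ∪ T) (fun x => f x * (q.eval x * r.eval x)) =
      ∑ x ∈ S, ∑ y ∈ T, (q.eval x / ∏ z ∈ S.erase x, (x - z)) *
        (r.eval y / ∏ z ∈ T.erase y, (y - z)) * ((f y - f x) / (y - x)) := by
  -- At a node x of S the factor r(x) / ∏ (x - y) over T is expanded in partial fractions. The nodes
  -- of T are treated symmetrically below, and the two halves combine into the quotients (f y - f x)
  -- / (y - x).
  have hS : ∑ x ∈ S, f x * (q.eval x * r.eval x) / ∏ y ∈ (S ∪ T).erase x, (x - y) =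
      ∑ x ∈ S, ∑ y ∈ T, (q.eval x / ∏ z ∈ S.erase x, (x - z)) *
        (r.eval y / ∏ z ∈ T.erase y, (y - z)) * (f x / (x - y)) := by
    refine Finset.sum_congr rfl fun x hx => ?_
    rw [prod_erase_union_left h hx]
    have := sum_div_sub hr (Finset.disjoint_left.1 h hx)
    calc _ = f x * (q.eval x / ∏ z ∈ S.erase x, (x - z)) * (r.eval x / ∏ y ∈ T, (x - y)) := by
          rw [mul_div_mul_comm, ← mul_div_assoc, ← mul_div_assoc]
          ring
      _ = _ := by
          rw [← this, Finset.mul_sum]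
          refine Finset.sum_congr rfl fun y _ => ?_
          ring
  have hT : ∑ y ∈ T, f y * (q.eval y * r.eval y) / ∏ z ∈ (S ∪ T).erase y, (y - z) =
      ∑ y ∈ T, ∑ x ∈ S, (q.eval x / ∏ z ∈ S.erase x, (x - z)) *
        (r.eval y / ∏ z ∈ T.erase y, (y - z)) * (f y / (y - x)) := by
    refine Finset.sum_congr rfl fun y hy => ?_
    rw [Finset.union_comm, prod_erase_union_left h.symm hy]
    have := sum_div_sub hq (Finset.disjoint_right.1 h hy)
    calc _ = f y * (r.eval y / ∏ z ∈ T.erase y, (y - z)) * (q.eval y / ∏ x ∈ S, (y - x)) := by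
          rw [mul_comm (q.eval y), mul_div_mul_comm, ← mul_div_assoc, ← mul_div_assoc]
          ring
      _ = _ := by
          rw [← this, Finset.mul_sum]
          refine Finset.sum_congr rfl fun y _ => ?_
          ring
  rw [divDiff, Finset.sum_union h, hS, hT, Finset.sum_comm (s := T), ← Finset.sum_add_distrib]
  refine Finset.sum_congr rfl fun x hx => ?_
  rw [← Finset.sum_add_distrib]
  refine Finset.sum_congr rfl fun y hy => ?_
  have hne : y - x ≠ 0 := sub_ne_zero.2 fun e => Finset.disjoint_left.1 h hx (e ▸ hy)
  have : f x / (x - y) = -(f x / (y - x)) := by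
    rw [← neg_sub y x, div_neg]
  rw [this, sub_div]
  ring

/-- Write f(x) = f(α) + (x - α) f[x, α]; the factor x - α cancels the node α. With h = q² the last
term will vanish for degree reasons. -/
theorem divDiff_insert_mul {U : Finset ℝ} {α : ℝ} (hα : α ∉ U) (f h : ℝ → ℝ) :
    divDiff (insert α U) (fun x => f x * h x) =
      divDiff U (fun x => (f x - f α) / (x - α) * h x) + f α * divDiff (insert α U) h := by
  have key : ∀ g : ℝ → ℝ, divDiff (insert α U) g =
      g α / ∏ y ∈ U, (α - y) + ∑ x ∈ U, g x / (x - α) / ∏ y ∈ U.erase x, (x - y) := by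
    intro g
    rw [divDiff, Finset.sum_insert hα, Finset.erase_insert hα]
    congr 1
    refine Finset.sum_congr rfl fun x hx => ?_
    have hne : x ≠ α := fun e => hα (e ▸ hx)
    rw [Finset.erase_insert_of_ne hne.symm, Finset.prod_insert (fun hm => hα (Finset.mem_of_mem_erase hm)),
      div_div]
  rw [key, key, divDiff, mul_add, Finset.mul_sum, add_left_comm, ← Finset.sum_add_distrib, mul_div_assoc]
  congr 1
  refine Finset.sum_congr rfl fun x hx => ?_
  ring

end DivDiff

/-! ### Mean value theorem for divided differences -/

section MeanValue

open Finset Polynomial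

/-- Iterated Rolle theorem. -/
theorem exists_iteratedDeriv_eq_zero {l u : ℝ} (m : ℕ) : ∀ {h : ℝ → ℝ}, ContDiff ℝ m h →
    ∀ {S : Finset ℝ}, #S = m + 1 → (∀ x ∈ S, x ∈ Set.Ioo l u) → (∀ x ∈ S, h x = 0) →
    ∃ ξ ∈ Set.Ioo l u, iteratedDeriv m h ξ = 0 := by
  induction m with
  | zero =>
    intro h _ S hS hI h0
    obtain ⟨x, hx⟩ : S.Nonempty := Finset.card_pos.1 (by omega)
    exact ⟨x, hI x hx, by simpa using h0 x hx⟩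
  | succ m ih =>
    intro h hh S hS hI h0
    set e := S.orderEmbOfFin hS
    have hmem : ∀ i, e i ∈ S := fun i => S.orderEmbOfFin_mem hS i
    -- Rolle between consecutive nodes gives m + 1 zeros of the derivative, one in each gap.
    have hr : ∀ i : Fin (m + 1), ∃ c ∈ Set.Ioo (e i.castSucc) (e i.succ), deriv h c = 0 := by
      intro i
      refine exists_deriv_eq_zero (e.strictMono i.castSucc_lt_succ) hh.continuous.continuousOn ?_
      rw [h0 _ (hmem _), h0 _ (hmem _)]
    choose c hc hc0 using hr
    have hmono : StrictMono c := by
      rw [Fin.strictMono_iff_lt_succ]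
      intro i
      refine (hc i.castSucc).2.trans ?_
      exact (hc i.succ).1
    rw [iteratedDeriv_succ']
    have hd : ContDiff ℝ m (deriv h) := by
      have : ContDiff ℝ ((m : ℕ∞) + 1) h := by exact_mod_cast hh
      exact (contDiff_succ_iff_deriv.1 this).2.2
    refine ih hd (S := univ.image c) ?_ ?_ ?_
    · rw [Finset.card_image_of_injective _ hmono.injective, Finset.card_univ, Fintype.card_fin]
    · intro x hx
      obtain ⟨i, _, rfl⟩ := Finset.mem_image.1 hx
      exact ⟨(hI _ (hmem _)).1.trans (hc i).1, (hc i).2.trans (hI _ (hmem _)).2⟩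
    · intro x hx
      obtain ⟨i, _, rfl⟩ := Finset.mem_image.1 hx
      exact hc0 i

theorem iteratedDeriv_polynomial (p : ℝ[X]) (k : ℕ) :
    iteratedDeriv k p.eval = (derivative^[k] p).eval := by
  induction k with
  | zero => simp
  | succ k ih =>
    rw [iteratedDeriv_succ, ih, Function.iterate_succ_apply']
    ext x
    exact Polynomial.deriv _

/-- Mean value theorem for divided differences. -/
theorem exists_divDiff_eq_iteratedDeriv {l u : ℝ} {m : ℕ} {g : ℝ → ℝ} (hg : ContDiff ℝ m g)
    {S : Finset ℝ} (hS : #S = m + 1) (hI : ∀ x ∈ S, x ∈ Set.Ioo l u) :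
    ∃ ξ ∈ Set.Ioo l u, m.factorial * divDiff S g = iteratedDeriv m g ξ := by
  -- The difference of `g` and its interpolant vanishes at m + 1 nodes, and the m-th derivative of
  -- the interpolant is the constant m! times the divided difference.
  set p := Lagrange.interpolate S id g
  have hinj : Set.InjOn (id : ℝ → ℝ) S := Set.injOn_id _
  have hp : p.degree < #S := Lagrange.degree_interpolate_lt g hinj
  have hv : ∀ x ∈ S, p.eval x = g x := fun x hx =>
    Lagrange.eval_interpolate_at_node (v := id) g hinj hx
  have hpc : ContDiff ℝ m p.eval := by
    simpa [Polynomial.coe_aeval_eq_eval] using p.contDiff_aeval (𝕜 := ℝ) (n := m)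
  obtain ⟨ξ, hξ, h0⟩ := exists_iteratedDeriv_eq_zero (l := l) (u := u) m (hg.sub hpc) hS hI
    (fun x hx => by simp [hv x hx])
  refine ⟨ξ, hξ, ?_⟩
  replace h0 : iteratedDeriv m (g - p.eval) ξ = 0 := h0
  have hsub := iteratedDeriv_sub (x := ξ) hg.contDiffAt hpc.contDiffAt
  rw [h0, iteratedDeriv_polynomial] at hsub
  beta_reduce at hsub
  rw [Lagrange.eval_iterate_derivative_eq_sum hinj hp (k := m) (by omega)] at hsub
  rw [eq_comm, ← sub_eq_zero, hsub, divDiff]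
  congr 2
  refine Finset.sum_congr rfl fun x hx => ?_
  simp [hS, hv x hx]

end MeanValue

/-! ### Confluent divided differences as quadratic forms -/

section Confluent

open Finset Polynomial Filter Topology

theorem eventually_disjoint_image_add (S : Finset ℝ) :
    ∀ᶠ ε : ℝ in 𝓝[>] 0, Disjoint S (S.image (· + ε)) := by
  have : ∀ᶠ ε : ℝ in 𝓝[>] 0, ∀ x ∈ S, ∀ y ∈ S, x ≠ y + ε := by
    rw [Filter.eventually_all_finset]
    intro x _
    rw [Filter.eventually_all_finset]
    intro y _
    rcases eq_or_ne x y with rfl | h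
    · filter_upwards [self_mem_nhdsWithin] with ε hε he
      have : (0 : ℝ) < ε := hε
      linarith
    · apply eventually_nhdsWithin_of_eventually_nhds
      have : ContinuousAt (fun ε : ℝ => y + ε) 0 := by fun_prop
      have h2 := this.eventually_ne (y := x) (by simpa using h.symm)
      filter_upwards [h2] with ε h
      exact h.symm
  filter_upwards [this] with ε h
  rw [Finset.disjoint_left]
  intro x hx hx'
  obtain ⟨y, hy, rfl⟩ := Finset.mem_image.1 hx'
  exact h _ hx y hy rfl

theorem prod_erase_image_add (S : Finset ℝ) (ε y : ℝ) :
    ∏ z ∈ (S.image (· + ε)).erase (y + ε), (y + ε - z) = ∏ z ∈ S.erase y, (y - z) := by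
  have hinj : Function.Injective fun x : ℝ => x + ε := add_left_injective ε
  have : (S.image (· + ε)).erase (y + ε) = (S.erase y).image (· + ε) := by
    rw [Finset.image_erase hinj]
  rw [this, Finset.prod_image (hinj.injOn)]
  simp

/-- As two copies of a node set merge, divided differences converge to a quadratic form. -/
theorem tendsto_divDiff_union {S : Finset ℝ} {q : ℝ[X]} (hq : q.degree < #S) {g : ℝ → ℝ}
    {Φ : ℝ → ℝ → ℝ} (hΦ : ∀ x ∈ S, ∀ y ∈ S, ∀ᶠ y' in 𝓝 y, x ≠ y' → (g y' - g x) / (y' - x) = Φ x y')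
    (hc : ∀ x ∈ S, ∀ y ∈ S, ContinuousAt (Φ x) y) :
    Tendsto (fun ε => divDiff (S ∪ S.image (· + ε)) fun x => g x * (q.eval x * q.eval x)) (𝓝[>] 0)
      (𝓝 (∑ x ∈ S, ∑ y ∈ S, (q.eval x / ∏ z ∈ S.erase x, (x - z)) *
        (q.eval y / ∏ z ∈ S.erase y, (y - z)) * Φ x y)) := by
  have hadd : ∀ y : ℝ, Tendsto (fun ε => y + ε) (𝓝[>] 0) (𝓝 y) := by
    intro y
    have : ContinuousAt (fun ε : ℝ => y + ε) 0 := by fun_prop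
    have h := this.tendsto
    rw [add_zero] at h
    exact h.mono_left nhdsWithin_le_nhds
  have h1 : Tendsto (fun ε : ℝ => ∑ x ∈ S, ∑ y ∈ S, (q.eval x / ∏ z ∈ S.erase x, (x - z)) *
        (q.eval (y + ε) / ∏ z ∈ S.erase y, (y - z)) * Φ x (y + ε)) (𝓝[>] 0)
      (𝓝 (∑ x ∈ S, ∑ y ∈ S, (q.eval x / ∏ z ∈ S.erase x, (x - z)) *
        (q.eval y / ∏ z ∈ S.erase y, (y - z)) * Φ x y)) := by
    refine tendsto_finsetSum _ fun x hx => tendsto_finsetSum _ fun y hy => ?_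
    refine Tendsto.mul (Tendsto.const_mul _ (Tendsto.div_const ?_ _)) ?_
    · exact (q.continuous.tendsto y).comp (hadd y)
    · exact (hc x hx y hy).tendsto.comp (hadd y)
  refine h1.congr' ?_
  have hev : ∀ᶠ ε : ℝ in 𝓝[>] 0, ∀ x ∈ S, ∀ y ∈ S, x ≠ y + ε →
      (g (y + ε) - g x) / (y + ε - x) = Φ x (y + ε) := by
    rw [Filter.eventually_all_finset]
    intro x hx
    rw [Filter.eventually_all_finset]
    intro y hy
    exact (hadd y).eventually (hΦ x hx y hy)
  filter_upwards [eventually_disjoint_image_add S, hev] with ε hd he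
  have hinj : Function.Injective fun x : ℝ => x + ε := add_left_injective ε
  have hcard : #(S.image (· + ε)) = #S := Finset.card_image_of_injective _ hinj
  -- For small ε > 0 the nodes and their translates are disjoint, and the divided difference is
  -- exactly the form with the second variable shifted by ε, since the nodal products are
  -- translation invariant.
  rw [divDiff_union hd hq (by rwa [hcard])]
  refine Finset.sum_congr rfl fun x hx => ?_
  rw [Finset.sum_image hinj.injOn]
  refine Finset.sum_congr rfl fun y hy => ?_
  rw [prod_erase_image_add, he x hx y hy]
  intro h
  exact Finset.disjoint_left.1 hd hx (Finset.mem_image.2 ⟨y, hy, h.symm⟩)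

theorem eventually_image_add_subset {S : Finset ℝ} {U : Set ℝ} (hU : IsOpen U)
    (hS : ∀ x ∈ S, x ∈ U) :
    ∀ᶠ ε : ℝ in 𝓝[>] 0, ∀ x ∈ S ∪ S.image (· + ε), x ∈ U := by
  have : ∀ᶠ ε : ℝ in 𝓝[>] 0, ∀ x ∈ S, x + ε ∈ U := by
    rw [Filter.eventually_all_finset]
    intro x hx
    apply eventually_nhdsWithin_of_eventually_nhds
    have h : ContinuousAt (fun ε : ℝ => x + ε) 0 := by fun_prop
    exact h.eventually (hU.mem_nhds (by simpa using hS x hx))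
  filter_upwards [this] with ε h x hx
  rcases Finset.mem_union.1 hx with hx | hx
  · exact hS x hx
  · obtain ⟨y, hy, rfl⟩ := Finset.mem_image.1 hx
    exact h y hy

/-- The confluent weights of a polynomial at a family of nodes. -/
noncomputable def nodeWeight {n : ℕ} (γ : Fin n → ℝ) (q : ℝ[X]) (i : Fin n) : ℝ :=
  q.eval (γ i) / ∏ z ∈ (univ.image γ).erase (γ i), (γ i - z)

/-- Interpolation at distinct nodes prescribes the values of q freely, hence the weights. Positivity
for all q therefore means positivity of the form on all real vectors. -/
theorem exists_nodeWeight_eq {n : ℕ} {γ : Fin n → ℝ} (hγ : Function.Injective γ) (r : Fin n → ℝ) :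
    ∃ q : ℝ[X], q.degree < n ∧ nodeWeight γ q = r := by
  set v : Fin n → ℝ := fun i => r i * ∏ z ∈ (univ.image γ).erase (γ i), (γ i - z)
  refine ⟨Lagrange.interpolate univ γ v, ?_, ?_⟩
  · simpa using Lagrange.degree_interpolate_lt (s := univ) (v := γ) v hγ.injOn
  · ext i
    rw [nodeWeight, Lagrange.eval_interpolate_at_node v hγ.injOn (mem_univ i)]
    refine mul_div_cancel_right₀ _ (Finset.prod_ne_zero_iff.2 fun z hz => sub_ne_zero.2 ?_)
    exact (Finset.ne_of_mem_erase hz).symm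

/-- The quadratic form of the Loewner matrix is controlled by the derivatives of `f q²`. -/
theorem factorial_mul_sum_dslope_mem {n : ℕ} (hn : 1 ≤ n) {f : ℝ → ℝ} (hf : ContDiff ℝ (↑(⊤ : ℕ∞)) f)
    {q : ℝ[X]} (hq : q.degree < n) {l u : ℝ} {K : Set ℝ} (hK : IsClosed K)
    (hd : ∀ ξ ∈ Set.Ioo l u,
      iteratedDeriv (2 * n - 1) (fun x => f x * (q.eval x * q.eval x)) ξ ∈ K)
    {γ : Fin n → ℝ} (hγ : Function.Injective γ) (hI : ∀ i, γ i ∈ Set.Ioo l u) :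
    ((2 * n - 1).factorial : ℝ) *
      ∑ i, ∑ k, nodeWeight γ q i * nodeWeight γ q k * dslope f (γ i) (γ k) ∈ K := by
  set S : Finset ℝ := univ.image γ
  have hS : #S = n := by
    rw [Finset.card_image_of_injective _ hγ, Finset.card_univ, Fintype.card_fin]
  have hf1 : ContDiff ℝ 1 f := hf.of_le (by exact_mod_cast le_top)
  have hlim := tendsto_divDiff_union (S := S) (q := q) (g := f) (Φ := dslope f) (by rwa [hS])
    (fun x _ y _ => Eventually.of_forall fun y' h => (dslope_eq_div h).symm)
    (fun x _ y _ => ((continuous_dslope hf1).comp (Continuous.prodMk_right x)).continuousAt)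
  have hsum : ∑ x ∈ S, ∑ y ∈ S, (q.eval x / ∏ z ∈ S.erase x, (x - z)) *
        (q.eval y / ∏ z ∈ S.erase y, (y - z)) * dslope f x y =
      ∑ i, ∑ k, nodeWeight γ q i * nodeWeight γ q k * dslope f (γ i) (γ k) := by
    rw [Finset.sum_image hγ.injOn]
    refine Finset.sum_congr rfl fun i _ => ?_
    rw [Finset.sum_image hγ.injOn]
    rfl
  rw [hsum] at hlim
  have hSI : ∀ x ∈ S, x ∈ Set.Ioo l u := by
    intro x hx
    obtain ⟨i, _, rfl⟩ := Finset.mem_image.1 hx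
    exact hI i
  refine hK.mem_of_tendsto (hlim.const_mul _) ?_
  filter_upwards [eventually_disjoint_image_add S, eventually_image_add_subset isOpen_Ioo hSI]
    with ε hdis hsub
  have hg : ContDiff ℝ (2 * n - 1 : ℕ) fun x => f x * (q.eval x * q.eval x) := by
    have h1 : ContDiff ℝ (2 * n - 1 : ℕ) f := contDiff_infty.1 hf _
    have h2 : ContDiff ℝ (2 * n - 1 : ℕ) q.eval := by
      simpa [Polynomial.coe_aeval_eq_eval] using q.contDiff_aeval (𝕜 := ℝ) (n := (2 * n - 1 : ℕ))
    exact h1.mul (h2.mul h2)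
  -- There are 2n nodes, hence a derivative of order 2n - 1. The intermediate point depends on ε,
  -- which is harmless because `K` is closed.
  obtain ⟨ξ, hξ, h⟩ := exists_divDiff_eq_iteratedDeriv hg (S := S ∪ S.image (· + ε)) (by
    rw [Finset.card_union_of_disjoint hdis, Finset.card_image_of_injective _ (add_left_injective ε), hS]
    omega) hsub
  rw [h]
  exact hd ξ hξ

/-- The quadratic form of the Kraus matrix is controlled by the derivatives of `f q²`. -/
theorem factorial_mul_sum_krausTerm_mem {n : ℕ} {f : ℝ → ℝ} (hf : ContDiff ℝ (↑(⊤ : ℕ∞)) f)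
    {q : ℝ[X]} (hq : q.degree < n) {l u : ℝ} {K : Set ℝ} (hK : IsClosed K)
    (hd : ∀ ξ ∈ Set.Ioo l u,
      iteratedDeriv (2 * n) (fun x => f x * (q.eval x * q.eval x)) ξ ∈ K)
    {γ : Fin n → ℝ} (hγ : Function.Injective γ) (hI : ∀ i, γ i ∈ Set.Ioo l u)
    {α : ℝ} (hα : α ∈ Set.Ioo l u) (hαγ : ∀ i, α ≠ γ i) :
    ((2 * n).factorial : ℝ) *
      ∑ i, ∑ k, nodeWeight γ q i * nodeWeight γ q k *
        (krausTerm f α (γ i) (γ k) / ((α - γ i) * (α - γ k))) ∈ K := by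
  set S : Finset ℝ := univ.image γ
  have hS : #S = n := by
    rw [Finset.card_image_of_injective _ hγ, Finset.card_univ, Fintype.card_fin]
  have hαS : ∀ x ∈ S, α ≠ x := by
    intro x hx
    obtain ⟨i, _, rfl⟩ := Finset.mem_image.1 hx
    exact hαγ i
  have hf1 : ContDiff ℝ 1 f := hf.of_le (by exact_mod_cast le_top)
  -- The confluence is applied to x ↦ f[x, α]. Its own divided differences are f[α, x, y], that is,
  -- `krausTerm` divided by (α - x)(α - y).
  have hlim := tendsto_divDiff_union (S := S) (q := q) (g := fun x => (f x - f α) / (x - α))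
    (Φ := fun x y => krausTerm f α x y / ((α - x) * (α - y))) (by rwa [hS])
    (fun x hx y hy => by
      filter_upwards [isOpen_ne.mem_nhds (hαS y hy).symm] with y' hy' hne
      have h1 : y' - α ≠ 0 := sub_ne_zero.2 hy'
      have h2 : x - α ≠ 0 := sub_ne_zero.2 (hαS x hx).symm
      have h3 : y' - x ≠ 0 := sub_ne_zero.2 hne.symm
      have h1' : α - y' ≠ 0 := sub_ne_zero.2 (Ne.symm hy')
      have h2' : α - x ≠ 0 := sub_ne_zero.2 (hαS x hx)
      rw [krausTerm, dslope_eq_div hne]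
      field_simp
      ring)
    (fun x hx y hy => by
      have h1 : Continuous (krausTerm f α x) :=
        (continuous_krausTerm hf1 α).comp (Continuous.prodMk_right x)
      refine h1.continuousAt.div (by fun_prop) ?_
      exact mul_ne_zero (sub_ne_zero.2 (hαS x hx)) (sub_ne_zero.2 (hαS y hy)))
  have hsum : ∑ x ∈ S, ∑ y ∈ S, (q.eval x / ∏ z ∈ S.erase x, (x - z)) *
        (q.eval y / ∏ z ∈ S.erase y, (y - z)) * (krausTerm f α x y / ((α - x) * (α - y))) =
      ∑ i, ∑ k, nodeWeight γ q i * nodeWeight γ q k *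
        (krausTerm f α (γ i) (γ k) / ((α - γ i) * (α - γ k))) := by
    rw [Finset.sum_image hγ.injOn]
    refine Finset.sum_congr rfl fun i _ => ?_
    rw [Finset.sum_image hγ.injOn]
    rfl
  rw [hsum] at hlim
  have hSI : ∀ x ∈ S, x ∈ Set.Ioo l u ∩ {α}ᶜ := by
    intro x hx
    refine ⟨?_, (hαS x hx).symm⟩
    obtain ⟨i, _, rfl⟩ := Finset.mem_image.1 hx
    exact hI i
  refine hK.mem_of_tendsto (hlim.const_mul _) ?_
  filter_upwards [eventually_disjoint_image_add S,
    eventually_image_add_subset (isOpen_Ioo.inter isOpen_compl_singleton) hSI] with ε hdis hsub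
  set U := S ∪ S.image (· + ε)
  have hU : #U = 2 * n := by
    rw [Finset.card_union_of_disjoint hdis, Finset.card_image_of_injective _ (add_left_injective ε), hS]
    omega
  have hαU : α ∉ U := fun h => (hsub α h).2 rfl
  have hg : ContDiff ℝ (2 * n : ℕ) fun x => f x * (q.eval x * q.eval x) := by
    have h1 : ContDiff ℝ (2 * n : ℕ) f := contDiff_infty.1 hf _
    have h2 : ContDiff ℝ (2 * n : ℕ) q.eval := by
      simpa [Polynomial.coe_aeval_eq_eval] using q.contDiff_aeval (𝕜 := ℝ) (n := (2 * n : ℕ))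
    exact h1.mul (h2.mul h2)
  obtain ⟨ξ, hξ, h⟩ := exists_divDiff_eq_iteratedDeriv hg (S := insert α U) (by
    rw [Finset.card_insert_of_notMem hαU, hU]) (l := l) (u := u) (by
      intro x hx
      rcases Finset.mem_insert.1 hx with rfl | hx
      · exact hα
      · exact (hsub x hx).1)
  -- q² has degree at most 2n - 2, so its divided difference over 2n + 1 nodes is zero.
  have hpoly : divDiff (insert α U) (fun x => q.eval x * q.eval x) = 0 := by
    have hdeg : (q * q).degree < (2 * n : ℕ) := by
      by_cases hq0 : q = 0
      · rw [hq0, mul_zero, Polynomial.degree_zero]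
        exact WithBot.bot_lt_coe _
      · rw [Polynomial.degree_mul, Polynomial.degree_eq_natDegree hq0]
        rw [Polynomial.degree_eq_natDegree hq0] at hq
        have : q.natDegree < n := by exact_mod_cast hq
        have : q.natDegree + q.natDegree < 2 * n := by omega
        exact_mod_cast this
    have hcard : #(insert α U) = 2 * n + 1 := by rw [Finset.card_insert_of_notMem hαU, hU]
    have := divDiff_polynomial (S := insert α U) (p := q * q) (by
      rw [hcard]; exact hdeg.trans (by exact_mod_cast Nat.lt_succ_self _))
    rw [hcard, Polynomial.coeff_eq_zero_of_degree_lt (by simpa using hdeg)] at this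
    rw [← this]
    congr 1
    ext x
    simp
  rw [divDiff_insert_mul hαU, hpoly, mul_zero, add_zero] at h
  rw [h]
  exact hd ξ hξ

end Confluent

/-! ### Positivity of Loewner and Kraus forms versus derivatives of f q² -/

section Smooth

open Matrix Finset Polynomial Filter Topology

variable {n : ℕ}

theorem monotone_reForm_le {S : Set ℝ} {f : ℝ → ℝ} (h : IsMatrixMonotoneOn n S f)
    {A B : Matrix (Fin n) (Fin n) ℂ} (hA : A.IsHermitian) (hB : B.IsHermitian)
    (hAs : spectrum ℝ A ⊆ S) (hBs : spectrum ℝ B ⊆ S) (hAB : (B - A).PosSemidef)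
    (w : Fin n → ℂ) : reForm (cfc f A) w ≤ reForm (cfc f B) w := by
  have := (posSemidef_iff_reForm ((isHermitian_cfc f B).sub (isHermitian_cfc f A))).1
    (h A B hA hB hAs hBs hAB) w
  rw [reForm_sub] at this
  linarith

theorem isMatrixMonotoneOn_of_reForm_le {S : Set ℝ} {f : ℝ → ℝ}
    (h : ∀ A B : Matrix (Fin n) (Fin n) ℂ, A.IsHermitian → B.IsHermitian →
      spectrum ℝ A ⊆ S → spectrum ℝ B ⊆ S → (B - A).PosSemidef →
      ∀ w, reForm (cfc f A) w ≤ reForm (cfc f B) w) : IsMatrixMonotoneOn n S f := by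
  intro A B hA hB hAs hBs hAB
  rw [posSemidef_iff_reForm ((isHermitian_cfc f B).sub (isHermitian_cfc f A))]
  intro w
  rw [reForm_sub]
  linarith [h A B hA hB hAs hBs hAB w]

theorem isHermitian_convexity_defect (f : ℝ → ℝ) (A B : Matrix (Fin n) (Fin n) ℂ) (t : ℝ) :
    (t • cfc f A + (1 - t) • cfc f B - cfc f (t • A + (1 - t) • B)).IsHermitian :=
  ((isHermitian_real_smul (isHermitian_cfc f A) t).add
    (isHermitian_real_smul (isHermitian_cfc f B) (1 - t))).sub (isHermitian_cfc f _)

theorem convex_reForm_le {S : Set ℝ} {f : ℝ → ℝ} (h : IsMatrixConvexOn n S f)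
    {A B : Matrix (Fin n) (Fin n) ℂ} (hA : A.IsHermitian) (hB : B.IsHermitian)
    (hAs : spectrum ℝ A ⊆ S) (hBs : spectrum ℝ B ⊆ S) {t : ℝ} (h0 : 0 ≤ t) (h1 : t ≤ 1)
    (w : Fin n → ℂ) : reForm (cfc f (t • A + (1 - t) • B)) w ≤
      t * reForm (cfc f A) w + (1 - t) * reForm (cfc f B) w := by
  have := (posSemidef_iff_reForm (isHermitian_convexity_defect f A B t)).1
    (h A B hA hB hAs hBs t h0 h1) w
  rw [reForm_sub, reForm_add, reForm_smul, reForm_smul] at this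
  linarith

theorem isMatrixConvexOn_of_reForm_le {S : Set ℝ} {f : ℝ → ℝ}
    (h : ∀ A B : Matrix (Fin n) (Fin n) ℂ, A.IsHermitian → B.IsHermitian →
      spectrum ℝ A ⊆ S → spectrum ℝ B ⊆ S → ∀ t : ℝ, 0 ≤ t → t ≤ 1 →
      ∀ w, reForm (cfc f (t • A + (1 - t) • B)) w ≤
        t * reForm (cfc f A) w + (1 - t) * reForm (cfc f B) w) : IsMatrixConvexOn n S f := by
  intro A B hA hB hAs hBs t h0 h1
  rw [posSemidef_iff_reForm (isHermitian_convexity_defect f A B t)]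
  intro w
  rw [reForm_sub, reForm_add, reForm_smul, reForm_smul]
  linarith [h A B hA hB hAs hBs t h0 h1 w]

/-- Simultaneous description of two Hermitian matrices in an eigenbasis of the second one. -/
theorem exists_eigenbasis_description {A : Matrix (Fin n) (Fin n) ℂ} (hA : A.IsHermitian)
    (U : unitaryGroup (Fin n) ℂ) (γ : Fin n → ℝ) :
    ∃ (V : unitaryGroup (Fin n) ℂ) (α : Fin n → ℝ), Set.range α = spectrum ℝ A ∧
      conjDiagonal V α - diagonal (fun i => (γ i : ℂ)) =
        star (U : Matrix (Fin n) (Fin n) ℂ) * (A - conjDiagonal U γ) * (U : Matrix (Fin n) (Fin n) ℂ) ∧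
      ∀ (f : ℝ → ℝ) (w : Fin n → ℂ),
        reForm (cfc f A) w = reForm (conjDiagonal V (f ∘ α)) (star (U : Matrix (Fin n) (Fin n) ℂ) *ᵥ w) ∧
        reForm (cfc f (conjDiagonal U γ)) w =
          reForm (diagonal (fun i => (f (γ i) : ℂ))) (star (U : Matrix (Fin n) (Fin n) ℂ) *ᵥ w) := by
  obtain ⟨W, α, rfl⟩ := exists_conjDiagonal hA
  have hU : star (U : Matrix (Fin n) (Fin n) ℂ) * U = 1 := Unitary.coe_star_mul_self U
  have hU' : (U : Matrix (Fin n) (Fin n) ℂ) * star (U : Matrix (Fin n) (Fin n) ℂ) = 1 :=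
    Unitary.coe_mul_star_self U
  have key : ∀ e : Fin n → ℝ, conjDiagonal (star U * W) e =
      star (U : Matrix (Fin n) (Fin n) ℂ) * conjDiagonal W e * U := by
    intro e
    simp [conjDiagonal_apply, Matrix.mul_assoc]
  have key2 : ∀ e : Fin n → ℝ, diagonal (fun i => (e i : ℂ)) =
      star (U : Matrix (Fin n) (Fin n) ℂ) * conjDiagonal U e * U := by
    intro e
    rw [conjDiagonal_apply]
    calc _ = (star (U : Matrix (Fin n) (Fin n) ℂ) * U) * diagonal (fun i => (e i : ℂ)) *
          (star (U : Matrix (Fin n) (Fin n) ℂ) * U) := by rw [hU, Matrix.one_mul, Matrix.mul_one]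
      _ = _ := by simp only [Matrix.mul_assoc]
  have key3 : ∀ (M : Matrix (Fin n) (Fin n) ℂ) w, reForm (star (U : Matrix (Fin n) (Fin n) ℂ) * M * (U : Matrix (Fin n) (Fin n) ℂ))
      (star (U : Matrix (Fin n) (Fin n) ℂ) *ᵥ w) = reForm M w := by
    intro M w
    rw [← reForm_conj]
    congr 1
    calc _ = ((U : Matrix (Fin n) (Fin n) ℂ) * star (U : Matrix (Fin n) (Fin n) ℂ)) * M *
          ((U : Matrix (Fin n) (Fin n) ℂ) * star (U : Matrix (Fin n) (Fin n) ℂ)) := by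
          simp only [Matrix.mul_assoc]
      _ = _ := by rw [hU', Matrix.one_mul, Matrix.mul_one]
  refine ⟨star U * W, α, (spectrum_conjDiagonal _ _).symm, ?_, fun f w => ⟨?_, ?_⟩⟩
  · rw [key, key2, ← sub_mul, ← mul_sub]
  · rw [cfc_conjDiagonal, key, key3]
  · rw [cfc_conjDiagonal]
    have := key2 (f ∘ γ)
    simp only [Function.comp_apply] at this
    rw [this, key3]

theorem exists_lipschitz_deriv {f : ℝ → ℝ} (hf : ContDiff ℝ (↑(⊤ : ℕ∞)) f) (l u : ℝ) :
    ∃ L : ℝ, 0 ≤ L ∧ ∀ x ∈ Set.Icc l u, ∀ y ∈ Set.Icc l u,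
      |deriv f x - deriv f y| ≤ L * |x - y| := by
  have h1 : ContDiff ℝ 1 (deriv f) := by
    have h2 : ContDiff ℝ (1 + 1) f := contDiff_infty.1 hf 2
    exact (contDiff_succ_iff_deriv.1 h2).2.2
  obtain ⟨K, hK⟩ := h1.contDiffOn.exists_lipschitzOnWith one_ne_zero (convex_Icc l u) isCompact_Icc
  refine ⟨K, K.2, fun x hx y hy => ?_⟩
  have := hK.dist_le_mul x hx y hy
  rwa [Real.dist_eq, Real.dist_eq] at this

theorem isHermitian_ones : (Matrix.of fun _ _ => (1 : ℂ) : Matrix (Fin n) (Fin n) ℂ).IsHermitian := by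
  ext i j
  simp

theorem posSemidef_ones : (Matrix.of fun _ _ => (1 : ℂ) : Matrix (Fin n) (Fin n) ℂ).PosSemidef := by
  have : (Matrix.of fun _ _ => (1 : ℂ) : Matrix (Fin n) (Fin n) ℂ) =
      vecMulVec (fun _ => 1) (star fun _ => 1) := by
    ext i j
    simp [vecMulVec]
  rw [this]
  exact posSemidef_vecMulVec_self_star _

theorem hadamard_real_smul (s : ℝ) (M N : Matrix (Fin n) (Fin n) ℂ) : M ⊙ (s • N) = s • (M ⊙ N) := by
  ext i j
  simp
  ring

/-- Used on first order terms: after dividing an inequality with error s² M by s, the remaining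
error s M vanishes as s → 0. -/
theorem nonneg_of_forall_small {Q M η : ℝ} (hη : 0 < η)
    (h : ∀ s, 0 < s → s ≤ η → -(s * M) ≤ Q) : 0 ≤ Q := by
  have hlim : Tendsto (fun s : ℝ => -(s * M)) (𝓝[>] 0) (𝓝 0) := by
    have : ContinuousAt (fun s : ℝ => -(s * M)) 0 := by fun_prop
    have h := this.tendsto
    simp only [zero_mul, neg_zero] at h
    exact h.mono_left nhdsWithin_le_nhds
  refine le_of_tendsto hlim ?_
  filter_upwards [Ioc_mem_nhdsGT hη] with s hs
  exact h s hs.1 hs.2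

theorem norm_conj_apply_le (D : Matrix (Fin n) (Fin n) ℂ) (U : unitaryGroup (Fin n) ℂ) (i k : Fin n) :
    ‖(star (U : Matrix (Fin n) (Fin n) ℂ) * D * (U : Matrix (Fin n) (Fin n) ℂ)) i k‖ ≤
      n * ∑ i, ∑ k, ‖D i k‖ := by
  rw [Matrix.mul_assoc, Matrix.mul_apply]
  calc _ ≤ ∑ _j : Fin n, ∑ i, ∑ k, ‖D i k‖ := by
        refine norm_sum_le_of_le _ fun j _ => ?_
        rw [norm_mul]
        refine (mul_le_of_le_one_left (norm_nonneg _) ?_).trans (norm_mul_apply_le D U j k)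
        exact entry_norm_bound_of_unitary (star U).2 _ _
    _ = _ := by simp

theorem norm_star_mulVec_apply_le (U : unitaryGroup (Fin n) ℂ) (w : Fin n → ℂ) (i : Fin n) :
    ‖(star (U : Matrix (Fin n) (Fin n) ℂ) *ᵥ w) i‖ ≤ ∑ k, ‖w k‖ := by
  rw [mulVec, dotProduct]
  refine norm_sum_le_of_le _ fun j _ => ?_
  rw [norm_mul]
  exact mul_le_of_le_one_left (norm_nonneg _) (entry_norm_bound_of_unitary (star U).2 _ _)

/-- Second order estimate for matrix functions in the direction of `D`, uniform in the base point. -/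
theorem exists_abs_reForm_cfc_le {f : ℝ → ℝ} (hf : ContDiff ℝ (↑(⊤ : ℕ∞)) f) (l u : ℝ)
    (D : Matrix (Fin n) (Fin n) ℂ) (w : Fin n → ℂ) :
    ∃ M, ∀ (U : unitaryGroup (Fin n) ℂ) (γ : Fin n → ℝ), (∀ i, γ i ∈ Set.Ioo l u) →
      ∀ s : ℝ, (conjDiagonal U γ + s • D).IsHermitian →
      spectrum ℝ (conjDiagonal U γ + s • D) ⊆ Set.Ioo l u →
      |reForm (cfc f (conjDiagonal U γ + s • D)) w - reForm (cfc f (conjDiagonal U γ)) w -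
        s * reForm (loewner f γ ⊙ (star (U : Matrix (Fin n) (Fin n) ℂ) * D * (U : Matrix (Fin n) (Fin n) ℂ)))
          (star (U : Matrix (Fin n) (Fin n) ℂ) *ᵥ w)| ≤ s ^ 2 * M := by
  obtain ⟨L, hL0, hL⟩ := exists_lipschitz_deriv hf l u
  have hf1 : ContDiff ℝ 1 f := contDiff_infty.1 hf 1
  -- Unitary entries have modulus at most 1, so rotating costs only powers of n: one for `w`, and
  -- for `D` one per entry and two for the summation. Nothing depends on U, γ or s.
  refine ⟨L * n * ((n * ∑ i, ‖w i‖) * (n * (n * (n * ∑ i, ∑ k, ‖D i k‖)))) ^ 2,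
    fun U γ hγ s hs hsp => ?_⟩
  obtain ⟨V, α, hα, hD, hform⟩ := exists_eigenbasis_description hs U γ
  have hαI : ∀ j, α j ∈ Set.Ioo l u := fun j => hsp (hα ▸ Set.mem_range_self j)
  set D' := star (U : Matrix (Fin n) (Fin n) ℂ) * D * (U : Matrix (Fin n) (Fin n) ℂ)
  set w' := star (U : Matrix (Fin n) (Fin n) ℂ) *ᵥ w
  have h := abs_reForm_sub_le hL0 V α γ (fun i j k => abs_krausTerm_le hf1 hL
    (Set.Ioo_subset_Icc_self (hαI j)) (Set.Ioo_subset_Icc_self (hγ i))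
    (Set.Ioo_subset_Icc_self (hγ k)) hL0) w' (D := s • D') (by
      rw [hD, add_sub_cancel_left, Matrix.mul_smul, Matrix.smul_mul])
  obtain ⟨h1, h2⟩ := hform f w
  rw [h1, h2]
  rw [hadamard_real_smul, reForm_smul] at h
  have hD' : ∑ i, ∑ k, ‖(s • D') i k‖ ≤ |s| * (n * (n * (n * ∑ i, ∑ k, ‖D i k‖))) := by
    calc _ ≤ ∑ _i : Fin n, ∑ _k : Fin n, |s| * (n * ∑ i, ∑ k, ‖D i k‖) := by
          refine Finset.sum_le_sum fun i _ => Finset.sum_le_sum fun k _ => ?_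
          rw [Matrix.smul_apply, norm_smul, Real.norm_eq_abs]
          exact mul_le_mul_of_nonneg_left (norm_conj_apply_le D U i k) (abs_nonneg s)
      _ = _ := by simp; ring
  have hw' : ∑ i, ‖w' i‖ ≤ n * ∑ i, ‖w i‖ := by
    calc _ ≤ ∑ _i : Fin n, ∑ i, ‖w i‖ :=
          Finset.sum_le_sum fun i _ => norm_star_mulVec_apply_le U w i
      _ = _ := by simp
  calc _ ≤ L * n * ((∑ i, ‖w' i‖) * ∑ i, ∑ k, ‖(s • D') i k‖) ^ 2 := h
    _ ≤ L * n * ((n * ∑ i, ‖w i‖) * (|s| * (n * (n * (n * ∑ i, ∑ k, ‖D i k‖))))) ^ 2 := by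
        gcongr
    _ = |s| ^ 2 * (L * n * ((n * ∑ i, ‖w i‖) * (n * (n * (n * ∑ i, ∑ k, ‖D i k‖)))) ^ 2) := by ring
    _ = _ := by rw [sq_abs]

theorem reForm_loewner_hadamard_ones (f : ℝ → ℝ) (γ r : Fin n → ℝ) :
    reForm (loewner f γ ⊙ Matrix.of fun _ _ => 1) (fun i => (r i : ℂ)) =
      ∑ i, ∑ k, r i * r k * dslope f (γ i) (γ k) := by
  rw [reForm_eq_sum]
  refine Finset.sum_congr rfl fun i _ => Finset.sum_congr rfl fun k _ => ?_
  have : star (r i : ℂ) * (loewner f γ ⊙ Matrix.of fun _ _ => (1 : ℂ)) i k * (r k : ℂ) =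
      ((r i * r k * dslope f (γ i) (γ k) : ℝ) : ℂ) := by
    simp [loewner]
    ring
  rw [this, Complex.ofReal_re]

/-- Loewner matrices of a smooth matrix monotone function are positive semidefinite. -/
theorem loewner_form_nonneg_of_isMatrixMonotoneOn {f : ℝ → ℝ} (hf : ContDiff ℝ (↑(⊤ : ℕ∞)) f) {l u : ℝ}
    (hmono : IsMatrixMonotoneOn n (Set.Ioo l u) f) {γ : Fin n → ℝ} (hγ : ∀ i, γ i ∈ Set.Ioo l u)
    (r : Fin n → ℝ) : 0 ≤ ∑ i, ∑ k, r i * r k * dslope f (γ i) (γ k) := by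
  -- The all-ones matrix is positive semidefinite and is the unit for the Hadamard product, so the
  -- derivative in this direction is the Loewner matrix itself.
  set D : Matrix (Fin n) (Fin n) ℂ := Matrix.of fun _ _ => 1
  have hC : (conjDiagonal (1 : unitaryGroup (Fin n) ℂ) γ).IsHermitian := isHermitian_conjDiagonal _ _
  have hCs : spectrum ℝ (conjDiagonal (1 : unitaryGroup (Fin n) ℂ) γ) ⊆ Set.Ioo l u := by
    rw [spectrum_conjDiagonal]
    rintro _ ⟨i, rfl⟩
    exact hγ i
  obtain ⟨η, hη, hsp⟩ := exists_pos_spectrum_add_smul_subset hC (isHermitian_ones (n := n)) hCs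
  obtain ⟨M, hM⟩ := exists_abs_reForm_cfc_le hf l u D fun i => (r i : ℂ)
  rw [← reForm_loewner_hadamard_ones]
  refine nonneg_of_forall_small (M := M) hη fun s h0 hs => ?_
  have hH : (conjDiagonal (1 : unitaryGroup (Fin n) ℂ) γ + s • D).IsHermitian :=
    hC.add (isHermitian_real_smul isHermitian_ones s)
  have hs' := hsp s (by rwa [abs_of_pos h0])
  have h1 := hM 1 γ hγ s hH hs'
  simp only [OneMemClass.coe_one, star_one, one_mulVec, Matrix.one_mul, Matrix.mul_one] at h1
  have h2 := monotone_reForm_le hmono hC hH hCs hs' (by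
    rw [add_sub_cancel_left]
    exact posSemidef_ones.smul h0.le) fun i => (r i : ℂ)
  have h3 := (abs_le.1 h1).2
  have h4 := (abs_le.1 h1).1
  have h5 : s * (-(s * M)) ≤ s * reForm (loewner f γ ⊙ D) fun i => (r i : ℂ) := by nlinarith
  exact le_of_mul_le_mul_left h5 h0

/-- The `m`-th derivative of `f q²` at `x` is nonnegative for all polynomials `q` of degree `< n`. -/
def SquareDerivNonneg (n m : ℕ) (f : ℝ → ℝ) (x : ℝ) : Prop :=
  ∀ q : ℝ[X], q.degree < n → 0 ≤ iteratedDeriv m (fun x => f x * (q.eval x * q.eval x)) x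

theorem contDiff_mul_sq {f : ℝ → ℝ} (hf : ContDiff ℝ (↑(⊤ : ℕ∞)) f) (q : ℝ[X]) :
    ContDiff ℝ (↑(⊤ : ℕ∞)) fun x => f x * (q.eval x * q.eval x) := by
  have h2 : ContDiff ℝ (↑(⊤ : ℕ∞)) q.eval := by
    simpa [Polynomial.coe_aeval_eq_eval] using q.contDiff_aeval (𝕜 := ℝ) (n := (↑(⊤ : ℕ∞)))
  exact hf.mul (h2.mul h2)

/-- If a derivative of `f q²` is negative at a point, it is bounded away from zero near it. -/
theorem exists_nhds_iteratedDeriv_le {f : ℝ → ℝ} (hf : ContDiff ℝ (↑(⊤ : ℕ∞)) f) {q : ℝ[X]} {m : ℕ}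
    {l u x : ℝ} (hx : x ∈ Set.Ioo l u)
    (hneg : iteratedDeriv m (fun x => f x * (q.eval x * q.eval x)) x < 0) :
    ∃ c < 0, ∃ δ > 0, Set.Ioo (x - δ) (x + δ) ⊆ Set.Ioo l u ∧
      ∀ ξ ∈ Set.Ioo (x - δ) (x + δ),
        iteratedDeriv m (fun x => f x * (q.eval x * q.eval x)) ξ ∈ Set.Iic c := by
  set h := iteratedDeriv m fun x => f x * (q.eval x * q.eval x)
  have hc : Continuous h := (contDiff_mul_sq hf q).continuous_iteratedDeriv m (by exact_mod_cast le_top)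
  refine ⟨h x / 2, by linarith, ?_⟩
  have h1 : ∀ᶠ ξ in 𝓝 x, h ξ < h x / 2 := hc.continuousAt.eventually_lt_const (by linarith)
  obtain ⟨δ, hδ, hsub⟩ := Metric.mem_nhds_iff.1 (h1.and (isOpen_Ioo.mem_nhds hx))
  rw [Real.ball_eq_Ioo] at hsub
  exact ⟨δ, hδ, fun ξ hξ => (hsub hξ).2, fun ξ hξ => (hsub hξ).1.le⟩

theorem exists_injective_mem_Ioo (n : ℕ) (x : ℝ) {δ : ℝ} (hδ : 0 < δ) :
    ∃ γ : Fin n → ℝ, Function.Injective γ ∧ ∀ i, γ i ∈ Set.Ioo (x - δ) (x + δ) := by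
  refine ⟨fun i => x + δ * ((i : ℝ) / n), fun i j h => ?_, fun i => ?_⟩
  · have hn : (n : ℝ) ≠ 0 := by
      have := i.pos
      positivity
    have h2 : ((i : ℕ) : ℝ) = (j : ℕ) := by
      have h3 := mul_left_cancel₀ hδ.ne' (add_left_cancel h)
      field_simp at h3
      exact h3
    exact Fin.ext (by exact_mod_cast h2)
  · have hn : (0 : ℝ) < n := by exact_mod_cast i.pos
    have h1 : ((i : ℕ) : ℝ) / n < 1 := by
      rw [div_lt_one hn]
      exact_mod_cast i.2
    have h0 : 0 ≤ ((i : ℕ) : ℝ) / n := by positivity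
    constructor <;> nlinarith

/-- A negative derivative at x would stay below some c < 0 near x; the form at n distinct nodes
close to x, with the weights of q, would then be negative. -/
theorem squareDerivNonneg_of_loewner (hn : 1 ≤ n) {f : ℝ → ℝ} (hf : ContDiff ℝ (↑(⊤ : ℕ∞)) f) {l u : ℝ}
    (h : ∀ γ : Fin n → ℝ, (∀ i, γ i ∈ Set.Ioo l u) → ∀ r : Fin n → ℝ,
      0 ≤ ∑ i, ∑ k, r i * r k * dslope f (γ i) (γ k)) {x : ℝ} (hx : x ∈ Set.Ioo l u) :
    SquareDerivNonneg n (2 * n - 1) f x := by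
  intro q hq
  by_contra! hneg
  obtain ⟨c, hc, δ, hδ, hsub, hle⟩ := exists_nhds_iteratedDeriv_le hf hx hneg
  obtain ⟨γ, hinj, hγ⟩ := exists_injective_mem_Ioo n x hδ
  have h1 := factorial_mul_sum_dslope_mem hn hf hq isClosed_Iic hle hinj hγ
  have h2 := h γ (fun i => hsub (hγ i)) (nodeWeight γ q)
  have h3 : (0 : ℝ) < ((2 * n - 1).factorial : ℝ) := by positivity
  have h4 : (0 : ℝ) ≤ _ := mul_nonneg h3.le h2
  exact absurd (h4.trans h1) (not_le.2 hc)

/-- A family of points can be made injective, and distinct from `α`, by small translations. -/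
theorem eventually_perturbation_injective (γ : Fin n → ℝ) (α : ℝ) :
    ∀ᶠ δ : ℝ in 𝓝[>] 0, (Function.Injective fun i : Fin n => γ i + δ * ((i : ℝ) + 1)) ∧
      ∀ i : Fin n, α ≠ γ i + δ * ((i : ℝ) + 1) := by
  have hlin : ∀ a b : ℝ, (a ≠ 0 ∨ b ≠ 0) → ∀ᶠ δ : ℝ in 𝓝[>] 0, a + δ * b ≠ 0 := by
    intro a b hab
    by_cases ha : a = 0
    · have hb : b ≠ 0 := hab.resolve_left (not_not.2 ha)
      filter_upwards [self_mem_nhdsWithin] with δ hδ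
      have : (0 : ℝ) < δ := hδ
      rw [ha, zero_add]
      exact mul_ne_zero this.ne' hb
    · apply eventually_nhdsWithin_of_eventually_nhds
      have : ContinuousAt (fun δ : ℝ => a + δ * b) 0 := by fun_prop
      exact this.eventually_ne (y := 0) (by simpa using ha)
  have h1 : ∀ᶠ δ : ℝ in 𝓝[>] 0, ∀ i j : Fin n, i ≠ j →
      (γ i - γ j) + δ * ((i : ℝ) - j) ≠ 0 := by
    rw [eventually_all]
    intro i
    rw [eventually_all]
    intro j
    by_cases hij : i = j
    · exact Eventually.of_forall fun δ h => absurd hij h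
    · have : ((i : ℕ) : ℝ) - (j : ℕ) ≠ 0 := by
        rw [sub_ne_zero]
        intro h
        exact hij (Fin.ext (by exact_mod_cast h))
      exact (hlin _ _ (Or.inr this)).mono fun δ h _ => h
  have h2 : ∀ᶠ δ : ℝ in 𝓝[>] 0, ∀ i : Fin n, (γ i - α) + δ * ((i : ℝ) + 1) ≠ 0 := by
    rw [eventually_all]
    intro i
    exact hlin _ _ (Or.inr (by positivity))
  filter_upwards [h1, h2] with δ h1 h2
  refine ⟨fun i j hij => ?_, fun i hi => h2 i (by rw [hi]; ring)⟩
  by_contra hne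
  have hij' : γ i + δ * ((i : ℝ) + 1) = γ j + δ * ((j : ℝ) + 1) := hij
  exact h1 i j hne (by linarith)

theorem tendsto_perturbation (γ : Fin n → ℝ) (i : Fin n) :
    Tendsto (fun δ : ℝ => γ i + δ * ((i : ℝ) + 1)) (𝓝[>] 0) (𝓝 (γ i)) := by
  have : ContinuousAt (fun δ : ℝ => γ i + δ * ((i : ℝ) + 1)) 0 := by fun_prop
  have h := this.tendsto
  simp only [zero_mul, add_zero] at h
  exact h.mono_left nhdsWithin_le_nhds

/-- To prove a closed condition on families in `(l, u)` it suffices to treat injective families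
avoiding a given point. -/
theorem form_nonneg_of_injective {Φ : ℝ → ℝ → ℝ} (hΦ : Continuous fun p : ℝ × ℝ => Φ p.1 p.2)
    {l u : ℝ} (α : ℝ) (r : Fin n → ℝ)
    (h : ∀ γ : Fin n → ℝ, Function.Injective γ → (∀ i, γ i ∈ Set.Ioo l u) → (∀ i, α ≠ γ i) →
      0 ≤ ∑ i, ∑ k, r i * r k * Φ (γ i) (γ k)) {γ : Fin n → ℝ} (hγ : ∀ i, γ i ∈ Set.Ioo l u) :
    0 ≤ ∑ i, ∑ k, r i * r k * Φ (γ i) (γ k) := by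
  have hlim : Tendsto (fun δ : ℝ => ∑ i : Fin n, ∑ k : Fin n, r i * r k *
      Φ (γ i + δ * ((i : ℝ) + 1)) (γ k + δ * ((k : ℝ) + 1))) (𝓝[>] 0)
      (𝓝 (∑ i, ∑ k, r i * r k * Φ (γ i) (γ k))) := by
    refine tendsto_finsetSum _ fun i _ => tendsto_finsetSum _ fun k _ => Tendsto.const_mul _ ?_
    exact (hΦ.tendsto (γ i, γ k)).comp
      ((tendsto_perturbation γ i).prodMk_nhds (tendsto_perturbation γ k))
  have hI : ∀ᶠ δ : ℝ in 𝓝[>] 0, ∀ i : Fin n, γ i + δ * ((i : ℝ) + 1) ∈ Set.Ioo l u := by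
    rw [eventually_all]
    intro i
    exact (tendsto_perturbation γ i).eventually (isOpen_Ioo.mem_nhds (hγ i))
  refine ge_of_tendsto hlim ?_
  filter_upwards [hI, eventually_perturbation_injective γ α] with δ h1 h2
  exact h _ h2.1 h1 h2.2

/-- For distinct nodes the vector r is the weight vector of some q and the confluent mean value
result applies; coinciding nodes follow by continuity. -/
theorem loewner_form_nonneg_of_squareDerivNonneg (hn : 1 ≤ n) {f : ℝ → ℝ}
    (hf : ContDiff ℝ (↑(⊤ : ℕ∞)) f) {l u : ℝ}
    (h : ∀ x ∈ Set.Ioo l u, SquareDerivNonneg n (2 * n - 1) f x) {γ : Fin n → ℝ}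
    (hγ : ∀ i, γ i ∈ Set.Ioo l u) (r : Fin n → ℝ) :
    0 ≤ ∑ i, ∑ k, r i * r k * dslope f (γ i) (γ k) := by
  refine form_nonneg_of_injective (continuous_dslope (contDiff_infty.1 hf 1)) 0 r
    (fun γ hinj hγ _ => ?_) hγ
  obtain ⟨q, hq, rfl⟩ := exists_nodeWeight_eq hinj r
  have h1 := factorial_mul_sum_dslope_mem hn hf hq (isClosed_Ici (a := 0))
    (fun ξ hξ => h ξ hξ q hq) hinj hγ
  exact nonneg_of_mul_nonneg_right h1 (by positivity)

theorem kraus_form_nonneg_of_squareDerivNonneg {f : ℝ → ℝ}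
    (hf : ContDiff ℝ (↑(⊤ : ℕ∞)) f) {l u : ℝ}
    (h : ∀ x ∈ Set.Ioo l u, SquareDerivNonneg n (2 * n) f x) {α : ℝ} (hα : α ∈ Set.Ioo l u)
    {γ : Fin n → ℝ} (hγ : ∀ i, γ i ∈ Set.Ioo l u) (r : Fin n → ℝ) :
    0 ≤ ∑ i, ∑ k, r i * r k * krausTerm f α (γ i) (γ k) := by
  refine form_nonneg_of_injective (continuous_krausTerm (contDiff_infty.1 hf 1) α) α r
    (fun γ hinj hγ hne => ?_) hγ
  -- The extra factors α - γ_i cancel the denominators that turn `krausTerm` into a second divided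
  -- difference.
  obtain ⟨q, hq, hqr⟩ := exists_nodeWeight_eq hinj fun i => r i * (α - γ i)
  have h1 := factorial_mul_sum_krausTerm_mem hf hq (isClosed_Ici (a := 0))
    (fun ξ hξ => h ξ hξ q hq) hinj hγ hα hne
  have h2 := nonneg_of_mul_nonneg_right (Set.mem_Ici.1 h1) (by positivity)
  rw [hqr] at h2
  refine h2.trans (le_of_eq ?_)
  refine Finset.sum_congr rfl fun i _ => Finset.sum_congr rfl fun k _ => ?_
  have hi : α - γ i ≠ 0 := sub_ne_zero.2 (hne i)
  have hk : α - γ k ≠ 0 := sub_ne_zero.2 (hne k)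
  field_simp

end Smooth

/-! ### Local characterizations for smooth functions -/

section SmoothCharacterization

open Matrix Finset Polynomial Filter Topology

variable {n : ℕ}

theorem re_mul_star (a b : ℂ) : (a * star b).re = a.re * b.re + a.im * b.im := by
  simp

/-- A real form that is nonnegative on real vectors is nonnegative on complex vectors. -/
theorem sum_re_mul_star_nonneg {K : Fin n → Fin n → ℝ}
    (hK : ∀ r : Fin n → ℝ, 0 ≤ ∑ i, ∑ k, r i * r k * K i k) (z : Fin n → ℂ) :
    0 ≤ ∑ i, ∑ k, (z i * star (z k)).re * K i k := by
  have h1 := hK fun i => (z i).re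
  have h2 := hK fun i => (z i).im
  refine (add_nonneg h1 h2).trans (le_of_eq ?_)
  simp only [← Finset.sum_add_distrib, re_mul_star, add_mul]

theorem posSemidef_loewner {f : ℝ → ℝ} {γ : Fin n → ℝ}
    (h : ∀ r : Fin n → ℝ, 0 ≤ ∑ i, ∑ k, r i * r k * dslope f (γ i) (γ k)) :
    (loewner f γ).PosSemidef := by
  have hH : (loewner f γ).IsHermitian := by
    ext i k
    simp [loewner, dslope_symm f (γ k) (γ i)]
  rw [posSemidef_iff_reForm hH]
  intro w
  have := sum_re_mul_star_nonneg h fun i => star (w i)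
  refine this.trans (le_of_eq ?_)
  rw [reForm_eq_sum]
  refine Finset.sum_congr rfl fun i _ => Finset.sum_congr rfl fun k _ => ?_
  rw [← Complex.re_mul_ofReal]
  congr 1
  simp only [loewner, of_apply, star_star]
  ring

/-- Over N + 1 equal steps the quadratic losses add up to M / (N + 1), which tends to 0. This
replaces differentiating along the path. -/
theorem le_of_quadratic_lower_bound {g : ℝ → ℝ} {M : ℝ}
    (h : ∀ s ∈ Set.Icc (0 : ℝ) 1, ∀ t ∈ Set.Icc (0 : ℝ) 1, s ≤ t → -((t - s) ^ 2 * M) ≤ g t - g s) :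
    g 0 ≤ g 1 := by
  have hlim : Tendsto (fun N : ℕ => -(1 / ((N : ℝ) + 1) * M)) atTop (𝓝 0) := by
    have := (tendsto_one_div_add_atTop_nhds_zero_nat (𝕜 := ℝ)).mul_const M
    simpa using this.neg
  have key : ∀ N : ℕ, -(1 / ((N : ℝ) + 1) * M) ≤ g 1 - g 0 := by
    intro N
    have hN : (0 : ℝ) < (N : ℝ) + 1 := by positivity
    have htel := Finset.sum_range_sub (fun k : ℕ => g ((k : ℝ) / ((N : ℝ) + 1))) (N + 1)
    push_cast at htel
    rw [div_self hN.ne', zero_div] at htel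
    rw [← htel]
    calc -(1 / ((N : ℝ) + 1) * M) = ∑ k ∈ range (N + 1), -((1 / ((N : ℝ) + 1)) ^ 2 * M) := by
          rw [Finset.sum_const, Finset.card_range, nsmul_eq_mul]
          push_cast
          field_simp
      _ ≤ _ := by
          refine Finset.sum_le_sum fun k hk => ?_
          have hk' : (k : ℝ) + 1 ≤ (N : ℝ) + 1 := by
            have := Finset.mem_range.1 hk
            exact_mod_cast this
          have h0 : (0 : ℝ) ≤ k := Nat.cast_nonneg k
          have := h ((k : ℝ) / ((N : ℝ) + 1)) ⟨by positivity, by rw [div_le_one hN]; linarith⟩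
            (((k : ℝ) + 1) / ((N : ℝ) + 1)) ⟨by positivity, by rw [div_le_one hN]; linarith⟩
            (by gcongr; linarith)
          rwa [← sub_div, add_sub_cancel_left] at this
  have := le_of_tendsto hlim (Eventually.of_forall key)
  linarith

theorem posSemidef_conj {D : Matrix (Fin n) (Fin n) ℂ} (hD : D.PosSemidef)
    (U : unitaryGroup (Fin n) ℂ) :
    (star (U : Matrix (Fin n) (Fin n) ℂ) * D * (U : Matrix (Fin n) (Fin n) ℂ)).PosSemidef :=
  hD.conjTranspose_mul_mul_same _

theorem isMatrixMonotoneOn_of_loewner {f : ℝ → ℝ} (hf : ContDiff ℝ (↑(⊤ : ℕ∞)) f) {l u : ℝ}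
    (h : ∀ γ : Fin n → ℝ, (∀ i, γ i ∈ Set.Ioo l u) → ∀ r : Fin n → ℝ,
      0 ≤ ∑ i, ∑ k, r i * r k * dslope f (γ i) (γ k)) :
    IsMatrixMonotoneOn n (Set.Ioo l u) f := by
  refine isMatrixMonotoneOn_of_reForm_le fun A B hA hB hAs hBs hAB w => ?_
  set D := B - A with hD
  obtain ⟨M, hM⟩ := exists_abs_reForm_cfc_le hf l u D w
  have hpath : ∀ s : ℝ, A + s • D = s • B + (1 - s) • A := by
    intro s
    rw [hD, smul_sub, sub_smul, one_smul]
    abel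
  have hsp : ∀ s ∈ Set.Icc (0 : ℝ) 1, spectrum ℝ (A + s • D) ⊆ Set.Ioo l u := by
    intro s hs
    rw [hpath]
    exact spectrum_convexComb_subset_Ioo hB hA hBs hAs hs.1 hs.2
  have hH : ∀ s : ℝ, (A + s • D).IsHermitian := fun s =>
    hA.add (isHermitian_real_smul (hB.sub hA) s)
  have := le_of_quadratic_lower_bound (g := fun s => reForm (cfc f (A + s • D)) w) (M := M) ?_
  · simpa [hD] using this
  · intro s hs t ht hst
    obtain ⟨U, γ, hUγ⟩ := exists_conjDiagonal (hH s)
    have hγ : ∀ i, γ i ∈ Set.Ioo l u := by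
      intro i
      apply hsp s hs
      rw [hUγ, spectrum_conjDiagonal]
      exact ⟨i, rfl⟩
    have hst' : conjDiagonal U γ + (t - s) • D = A + t • D := by
      rw [← hUγ, sub_smul]
      abel
    have h1 := hM U γ hγ (t - s) (by rw [hst']; exact hH t) (by rw [hst']; exact hsp t ht)
    rw [hst', ← hUγ] at h1
    -- Schur product theorem: the Loewner matrix and the rotated increment are both positive
    -- semidefinite, hence so is the first order term.
    have h2 := ((posSemidef_loewner (h γ hγ)).hadamard (posSemidef_conj hAB U))
    have h3 := (posSemidef_iff_reForm h2.1).1 h2 (star (U : Matrix (Fin n) (Fin n) ℂ) *ᵥ w)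
    have h4 := mul_nonneg (sub_nonneg.2 hst) h3
    have h5 := (abs_le.1 h1).1
    linarith

/-- The remainder of the first order expansion of a matrix function, in eigenbases. -/
theorem exists_reForm_eq_sum_krausTerm (f : ℝ → ℝ) {A : Matrix (Fin n) (Fin n) ℂ}
    (hA : A.IsHermitian) (U : unitaryGroup (Fin n) ℂ) (γ : Fin n → ℝ) :
    ∃ (V : unitaryGroup (Fin n) ℂ) (α : Fin n → ℝ), Set.range α = spectrum ℝ A ∧
      conjDiagonal V α - diagonal (fun i => (γ i : ℂ)) =
        star (U : Matrix (Fin n) (Fin n) ℂ) * (A - conjDiagonal U γ) * (U : Matrix (Fin n) (Fin n) ℂ) ∧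
      ∀ w : Fin n → ℂ, reForm (cfc f A) w - reForm (cfc f (conjDiagonal U γ)) w -
        reForm (loewner f γ ⊙ (star (U : Matrix (Fin n) (Fin n) ℂ) * (A - conjDiagonal U γ) *
          (U : Matrix (Fin n) (Fin n) ℂ))) (star (U : Matrix (Fin n) (Fin n) ℂ) *ᵥ w) =
        ∑ j, ∑ i, ∑ k, (star ((star (U : Matrix (Fin n) (Fin n) ℂ) *ᵥ w) i) * (V : Matrix (Fin n) (Fin n) ℂ) i j *
          star (star ((star (U : Matrix (Fin n) (Fin n) ℂ) *ᵥ w) k) * (V : Matrix (Fin n) (Fin n) ℂ) k j)).re *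
          krausTerm f (α j) (γ i) (γ k) := by
  obtain ⟨V, α, hα, hD, hform⟩ := exists_eigenbasis_description hA U γ
  refine ⟨V, α, hα, hD, fun w => ?_⟩
  rw [(hform f w).1, (hform f w).2, ← hD, reForm_sub_eq_sum_krausTerm]

/-- Expand f(A) and f(B) around C = tA + (1 - t)B. Both remainders are sums of Kraus forms, hence
nonnegative, and the linear terms cancel because t(A - C) + (1 - t)(B - C) = 0. -/
theorem isMatrixConvexOn_of_kraus {f : ℝ → ℝ} {l u : ℝ}
    (h : ∀ α ∈ Set.Ioo l u, ∀ γ : Fin n → ℝ, (∀ i, γ i ∈ Set.Ioo l u) → ∀ r : Fin n → ℝ,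
      0 ≤ ∑ i, ∑ k, r i * r k * krausTerm f α (γ i) (γ k)) :
    IsMatrixConvexOn n (Set.Ioo l u) f := by
  refine isMatrixConvexOn_of_reForm_le fun A B hA hB hAs hBs t h0 h1 w => ?_
  have hCs := spectrum_convexComb_subset_Ioo hA hB hAs hBs h0 h1
  have hC := (isHermitian_real_smul hA t).add (isHermitian_real_smul hB (1 - t))
  obtain ⟨U, γ, hUγ⟩ := exists_conjDiagonal hC
  have hγ : ∀ i, γ i ∈ Set.Ioo l u := by
    intro i
    apply hCs
    rw [hUγ, spectrum_conjDiagonal]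
    exact ⟨i, rfl⟩
  have key : ∀ X : Matrix (Fin n) (Fin n) ℂ, X.IsHermitian → spectrum ℝ X ⊆ Set.Ioo l u →
      0 ≤ reForm (cfc f X) w - reForm (cfc f (conjDiagonal U γ)) w -
        reForm (loewner f γ ⊙ (star (U : Matrix (Fin n) (Fin n) ℂ) * (X - conjDiagonal U γ) *
          (U : Matrix (Fin n) (Fin n) ℂ))) (star (U : Matrix (Fin n) (Fin n) ℂ) *ᵥ w) := by
    intro X hX hXs
    obtain ⟨V, α, hα, -, hform⟩ := exists_reForm_eq_sum_krausTerm f hX U γ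
    rw [hform]
    refine Finset.sum_nonneg fun j _ => ?_
    exact sum_re_mul_star_nonneg (h (α j) (hXs (hα ▸ Set.mem_range_self j)) γ hγ)
      fun i => star ((star (U : Matrix (Fin n) (Fin n) ℂ) *ᵥ w) i) * (V : Matrix (Fin n) (Fin n) ℂ) i j
  have hlin : t * reForm (loewner f γ ⊙ (star (U : Matrix (Fin n) (Fin n) ℂ) * (A - conjDiagonal U γ) *
          (U : Matrix (Fin n) (Fin n) ℂ))) (star (U : Matrix (Fin n) (Fin n) ℂ) *ᵥ w) +
      (1 - t) * reForm (loewner f γ ⊙ (star (U : Matrix (Fin n) (Fin n) ℂ) * (B - conjDiagonal U γ) *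
          (U : Matrix (Fin n) (Fin n) ℂ))) (star (U : Matrix (Fin n) (Fin n) ℂ) *ᵥ w) = 0 := by
    have hconj : ∀ X Y : Matrix (Fin n) (Fin n) ℂ,
        t • (star (U : Matrix (Fin n) (Fin n) ℂ) * X * (U : Matrix (Fin n) (Fin n) ℂ)) +
          (1 - t) • (star (U : Matrix (Fin n) (Fin n) ℂ) * Y * (U : Matrix (Fin n) (Fin n) ℂ)) =
        star (U : Matrix (Fin n) (Fin n) ℂ) * (t • X + (1 - t) • Y) * (U : Matrix (Fin n) (Fin n) ℂ) := by
      intro X Y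
      rw [mul_add, add_mul, Matrix.mul_smul, Matrix.mul_smul, Matrix.smul_mul, Matrix.smul_mul]
    rw [← reForm_smul, ← reForm_smul, ← reForm_add, ← hadamard_real_smul, ← hadamard_real_smul,
      ← hadamard_add, hconj, ← hUγ]
    have : t • (A - (t • A + (1 - t) • B)) + (1 - t) • (B - (t • A + (1 - t) • B)) = 0 := by
      module
    rw [this]
    simp [reForm]
  have hA' := mul_nonneg h0 (key A hA hAs)
  have hB' := mul_nonneg (sub_nonneg.2 h1) (key B hB hBs)
  rw [hUγ]
  linarith

/-- A convex function lies above its tangent: compare f(C + s(A - C)) with the chord, divide by s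
and let s → 0. -/
theorem reForm_tangent_le_of_isMatrixConvexOn {f : ℝ → ℝ} (hf : ContDiff ℝ (↑(⊤ : ℕ∞)) f) {l u : ℝ}
    (hconv : IsMatrixConvexOn n (Set.Ioo l u) f) {A : Matrix (Fin n) (Fin n) ℂ}
    (hA : A.IsHermitian) (hAs : spectrum ℝ A ⊆ Set.Ioo l u) (U : unitaryGroup (Fin n) ℂ)
    {γ : Fin n → ℝ} (hγ : ∀ i, γ i ∈ Set.Ioo l u) (w : Fin n → ℂ) :
    0 ≤ reForm (cfc f A) w - reForm (cfc f (conjDiagonal U γ)) w -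
        reForm (loewner f γ ⊙ (star (U : Matrix (Fin n) (Fin n) ℂ) * (A - conjDiagonal U γ) *
          (U : Matrix (Fin n) (Fin n) ℂ))) (star (U : Matrix (Fin n) (Fin n) ℂ) *ᵥ w) := by
  set C := conjDiagonal U γ with hCdef
  have hC : C.IsHermitian := isHermitian_conjDiagonal U γ
  have hCs : spectrum ℝ C ⊆ Set.Ioo l u := by
    rw [hCdef, spectrum_conjDiagonal]
    rintro _ ⟨i, rfl⟩
    exact hγ i
  obtain ⟨M, hM⟩ := exists_abs_reForm_cfc_le hf l u (A - C) w
  refine nonneg_of_forall_small (M := M) one_pos fun s hs0 hs1 => ?_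
  have hpath : C + s • (A - C) = s • A + (1 - s) • C := by module
  have h1 := hM U γ hγ s
  rw [← hCdef, hpath] at h1
  replace h1 := h1 ((isHermitian_real_smul hA s).add (isHermitian_real_smul hC (1 - s)))
    (spectrum_convexComb_subset_Ioo hA hC hAs hCs hs0.le hs1)
  have h2 := convex_reForm_le hconv hA hC hAs hCs hs0.le hs1 w
  have h3 := (abs_le.1 h1).1
  refine le_of_mul_le_mul_left ?_ hs0
  nlinarith

/-- If the derivative is negative near x, choose distinct nodes there and perturb diag(γ) by τ times
the all-ones matrix. Eigenvectors of this rank one perturbation satisfy V_ij (α_j - γ_i) = τ y_j,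
with y_j the j-th column sum of V. So the j-th part of the remainder is τ² |y_j|² times the Kraus
form with the weights of q, which is negative. The tangent inequality then forces every y_j to
vanish, contradicting the invertibility of V. -/
theorem squareDerivNonneg_of_isMatrixConvexOn (hn : 1 ≤ n) {f : ℝ → ℝ}
    (hf : ContDiff ℝ (↑(⊤ : ℕ∞)) f) {l u : ℝ} (hconv : IsMatrixConvexOn n (Set.Ioo l u) f)
    {x : ℝ} (hx : x ∈ Set.Ioo l u) : SquareDerivNonneg n (2 * n) f x := by
  intro q hq
  by_contra! hneg
  obtain ⟨c, hc, δ, hδ, hsub, hle⟩ := exists_nhds_iteratedDeriv_le hf hx hneg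
  obtain ⟨γ, hinj, hγ⟩ := exists_injective_mem_Ioo n x hδ
  set D : Matrix (Fin n) (Fin n) ℂ := Matrix.of fun _ _ => 1 with hDdef
  have hC : (conjDiagonal (1 : unitaryGroup (Fin n) ℂ) γ).IsHermitian := isHermitian_conjDiagonal _ _
  have hCs : spectrum ℝ (conjDiagonal (1 : unitaryGroup (Fin n) ℂ) γ) ⊆ Set.Ioo (x - δ) (x + δ) := by
    rw [spectrum_conjDiagonal]
    rintro _ ⟨i, rfl⟩
    exact hγ i
  obtain ⟨τ, hτ, hsp⟩ := exists_pos_spectrum_add_smul_subset hC (isHermitian_ones (n := n)) hCs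
  replace hsp := hsp τ (abs_of_pos hτ).le
  set A := conjDiagonal (1 : unitaryGroup (Fin n) ℂ) γ + τ • D with hAdef
  have hA : A.IsHermitian := hC.add (isHermitian_real_smul isHermitian_ones τ)
  set r := nodeWeight γ q with hr
  have htan := reForm_tangent_le_of_isMatrixConvexOn hf hconv hA (hsp.trans hsub) 1
    (fun i => hsub (hγ i)) fun i => (r i : ℂ)
  obtain ⟨V, α, hα, hVD, hform⟩ := exists_reForm_eq_sum_krausTerm f hA 1 γ
  rw [hform] at htan
  simp only [OneMemClass.coe_one, star_one, one_mulVec, Matrix.one_mul, Matrix.mul_one] at htan hVD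
  have hαI : ∀ j, α j ∈ Set.Ioo (x - δ) (x + δ) := fun j => hsp (hα ▸ Set.mem_range_self j)
  set y : Fin n → ℂ := fun j => ∑ k, (V : Matrix (Fin n) (Fin n) ℂ) k j with hy
  have hV : ∀ i j, (V : Matrix (Fin n) (Fin n) ℂ) i j * ((α j : ℂ) - γ i) = τ * y j := by
    intro i j
    rw [← sub_diagonal_mul_apply, hVD, hAdef, add_sub_cancel_left, Matrix.smul_mul,
      Matrix.smul_apply, Matrix.mul_apply]
    simp [hDdef, hy]
  have hterm : ∀ j, ∑ i, ∑ k, (star (r i : ℂ) * (V : Matrix (Fin n) (Fin n) ℂ) i j *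
          star (star (r k : ℂ) * (V : Matrix (Fin n) (Fin n) ℂ) k j)).re *
          krausTerm f (α j) (γ i) (γ k) ≤ τ ^ 2 * ‖y j‖ ^ 2 * (c / ((2 * n).factorial : ℝ)) := by
    intro j
    -- If y_j = 0, then for each i either V_ij = 0 or α_j = γ_i, and in the latter case `krausTerm`
    -- vanishes.
    by_cases hyj : y j = 0
    · rw [hyj, norm_zero]
      have : ∀ i k, (star (r i : ℂ) * (V : Matrix (Fin n) (Fin n) ℂ) i j *
          star (star (r k : ℂ) * (V : Matrix (Fin n) (Fin n) ℂ) k j)).re *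
          krausTerm f (α j) (γ i) (γ k) = 0 := by
        intro i k
        have h0 := hV i j
        rw [hyj, mul_zero, mul_eq_zero] at h0
        rcases h0 with h0 | h0
        · simp [h0]
        · have : α j = γ i := by
            have := sub_eq_zero.1 h0
            exact_mod_cast this
          have h2 := sub_smul_dslope f (γ k) (γ i)
          rw [smul_eq_mul] at h2
          rw [this, krausTerm, dslope_symm f (γ i)]
          have : f (γ i) - f (γ k) - dslope f (γ k) (γ i) * (γ i - γ k) = 0 := by linarith
          rw [this, mul_zero]
      simp only [this]
      simp
    · have hne : ∀ i, α j ≠ γ i := by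
        intro i hi
        have h0 := hV i j
        rw [hi, sub_self, mul_zero] at h0
        exact mul_ne_zero (by exact_mod_cast hτ.ne') hyj h0.symm
      have h1 := factorial_mul_sum_krausTerm_mem hf hq isClosed_Iic hle hinj hγ (hαI j) hne
      have hfac : (0 : ℝ) < ((2 * n).factorial : ℝ) := by positivity
      have h2 : ∑ i, ∑ k, nodeWeight γ q i * nodeWeight γ q k *
          (krausTerm f (α j) (γ i) (γ k) / ((α j - γ i) * (α j - γ k))) ≤
          c / ((2 * n).factorial : ℝ) := by
        rw [le_div_iff₀ hfac, mul_comm]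
        exact h1
      refine le_trans (le_of_eq ?_) (mul_le_mul_of_nonneg_left h2 (by positivity))
      rw [Finset.mul_sum]
      refine Finset.sum_congr rfl fun i _ => ?_
      rw [Finset.mul_sum]
      refine Finset.sum_congr rfl fun k _ => ?_
      have hi : α j - γ i ≠ 0 := sub_ne_zero.2 (hne i)
      have hk : α j - γ k ≠ 0 := sub_ne_zero.2 (hne k)
      have hVe : ∀ i, (V : Matrix (Fin n) (Fin n) ℂ) i j = ((τ / (α j - γ i) : ℝ) : ℂ) * y j := by
        intro i
        have hi : ((α j : ℂ) - γ i) ≠ 0 := by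
          have := sub_ne_zero.2 (hne i)
          exact_mod_cast this
        push_cast
        rw [div_mul_eq_mul_div, eq_div_iff hi, hV]
      have hre : (star (r i : ℂ) * (V : Matrix (Fin n) (Fin n) ℂ) i j *
          star (star (r k : ℂ) * (V : Matrix (Fin n) (Fin n) ℂ) k j)).re =
          r i * r k * (τ / (α j - γ i)) * (τ / (α j - γ k)) * ‖y j‖ ^ 2 := by
        have : star (r i : ℂ) * (V : Matrix (Fin n) (Fin n) ℂ) i j *
          star (star (r k : ℂ) * (V : Matrix (Fin n) (Fin n) ℂ) k j) =
          ((r i * r k * (τ / (α j - γ i)) * (τ / (α j - γ k)) * ‖y j‖ ^ 2 : ℝ) : ℂ) := by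
          rw [hVe, hVe]
          have hyy : y j * star (y j) = ((‖y j‖ ^ 2 : ℝ) : ℂ) := by
            have := Complex.mul_conj (y j)
            rw [Complex.normSq_eq_norm_sq] at this
            exact this
          rw [Complex.ofReal_mul, ← hyy]
          simp only [star_mul', RCLike.star_def, Complex.conj_ofReal, Complex.ofReal_mul]
          ring
        rw [this, Complex.ofReal_re]
      rw [hre, ← hr]
      field_simp
  have hle2 := htan.trans (Finset.sum_le_sum fun j _ => hterm j)
  rw [← Finset.sum_mul] at hle2
  have hcn : c / ((2 * n).factorial : ℝ) < 0 := div_neg_of_neg_of_pos hc (by positivity)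
  have hsum : ∑ j, τ ^ 2 * ‖y j‖ ^ 2 ≤ 0 := by
    by_contra! hpos
    exact absurd hle2 (not_le.2 (mul_neg_of_pos_of_neg hpos hcn))
  have hy0 : ∀ j, y j = 0 := by
    intro j
    have hz := (Finset.sum_eq_zero_iff_of_nonneg (fun j _ => by positivity)).1
      (le_antisymm hsum (Finset.sum_nonneg fun j _ => by positivity)) j (mem_univ j)
    have := (mul_eq_zero.1 hz).resolve_left (by positivity)
    simpa using this
  have hvec : (fun _ : Fin n => (1 : ℂ)) ᵥ* (V : Matrix (Fin n) (Fin n) ℂ) = 0 := by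
    ext j
    simpa [vecMul, dotProduct] using hy0 j
  have hone : (fun _ : Fin n => (1 : ℂ)) = 0 := by
    have h1 : ((fun _ : Fin n => (1 : ℂ)) ᵥ* (V : Matrix (Fin n) (Fin n) ℂ)) ᵥ* star (V : Matrix (Fin n) (Fin n) ℂ) = 0 := by
      rw [hvec, zero_vecMul]
    rwa [vecMul_vecMul, Unitary.mul_star_self_of_mem V.2, vecMul_one] at h1
  have := congrFun hone ⟨0, hn⟩
  simp at this

/-- Local characterization of matrix monotonicity for smooth functions. -/
theorem isMatrixMonotoneOn_iff_squareDerivNonneg (hn : 1 ≤ n) {f : ℝ → ℝ}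
    (hf : ContDiff ℝ (↑(⊤ : ℕ∞)) f) {l u : ℝ} :
    IsMatrixMonotoneOn n (Set.Ioo l u) f ↔
      ∀ x ∈ Set.Ioo l u, SquareDerivNonneg n (2 * n - 1) f x :=
  ⟨fun h _ hx => squareDerivNonneg_of_loewner hn hf
    (fun _ hγ r => loewner_form_nonneg_of_isMatrixMonotoneOn hf h hγ r) hx,
  fun h => isMatrixMonotoneOn_of_loewner hf fun _ hγ r =>
    loewner_form_nonneg_of_squareDerivNonneg hn hf h hγ r⟩

/-- Local characterization of matrix convexity for smooth functions. -/
theorem isMatrixConvexOn_iff_squareDerivNonneg (hn : 1 ≤ n) {f : ℝ → ℝ}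
    (hf : ContDiff ℝ (↑(⊤ : ℕ∞)) f) {l u : ℝ} :
    IsMatrixConvexOn n (Set.Ioo l u) f ↔ ∀ x ∈ Set.Ioo l u, SquareDerivNonneg n (2 * n) f x :=
  ⟨fun h _ hx => squareDerivNonneg_of_isMatrixConvexOn hn hf h hx,
  fun h => isMatrixConvexOn_of_kraus fun _ hα _ hγ r =>
    kraus_form_nonneg_of_squareDerivNonneg hf h hα hγ r⟩

end SmoothCharacterization

/-! ### Mollification, and gluing of continuous functions -/

section Mollify

open MeasureTheory Filter Topology Matrix

variable {n : ℕ}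

/-- Convolution of a function with a normalized smooth bump. -/
noncomputable def mollify (φ : ContDiffBump (0 : ℝ)) (g : ℝ → ℝ) : ℝ → ℝ :=
  convolution (φ.normed volume) g (ContinuousLinearMap.lsmul ℝ ℝ) volume

theorem mollify_apply (φ : ContDiffBump (0 : ℝ)) (g : ℝ → ℝ) (x : ℝ) :
    mollify φ g x = ∫ t, φ.normed volume t * g (x - t) := rfl

theorem integrable_mollify (φ : ContDiffBump (0 : ℝ)) {g : ℝ → ℝ} (hg : LocallyIntegrable g) (x : ℝ) :
    Integrable fun t => φ.normed volume t * g (x - t) :=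
  φ.hasCompactSupport_normed.convolutionExists_left (ContinuousLinearMap.lsmul ℝ ℝ)
    φ.continuous_normed hg x

theorem contDiff_mollify (φ : ContDiffBump (0 : ℝ)) {g : ℝ → ℝ} (hg : LocallyIntegrable g) :
    ContDiff ℝ (↑(⊤ : ℕ∞)) (mollify φ g) :=
  φ.hasCompactSupport_normed.contDiff_convolution_left (ContinuousLinearMap.lsmul ℝ ℝ)
    φ.contDiff_normed hg

theorem abs_lt_of_normed_ne_zero {φ : ContDiffBump (0 : ℝ)} {t : ℝ} (h : φ.normed volume t ≠ 0) :
    |t| < φ.rOut := by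
  have : t ∈ Function.support (φ.normed volume) := h
  rw [φ.support_normed_eq, Metric.mem_ball, Real.dist_eq, sub_zero] at this
  exact this

theorem normed_mul_nonneg (φ : ContDiffBump (0 : ℝ)) {t y : ℝ} (h : |t| < φ.rOut → 0 ≤ y) :
    0 ≤ φ.normed volume t * y := by
  by_cases h0 : φ.normed volume t = 0
  · rw [h0, zero_mul]
  · exact mul_nonneg (φ.nonneg_normed t) (h (abs_lt_of_normed_ne_zero h0))

theorem mollify_le_of_monotone (φ : ContDiffBump (0 : ℝ)) {g : ℝ → ℝ} (hg : Monotone g) (x : ℝ) :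
    mollify φ g x ≤ g (x + φ.rOut) ∧ g (x - φ.rOut) ≤ mollify φ g x := by
  have hi := integrable_mollify φ hg.locallyIntegrable x
  have hc : ∀ y : ℝ, Integrable fun t => φ.normed volume t * y := fun y => φ.integrable_normed.mul_const y
  have hv : ∀ y : ℝ, y = ∫ t, φ.normed volume t * y := by
    intro y
    rw [integral_mul_const, φ.integral_normed, one_mul]
  constructor
  · rw [mollify_apply, hv (g (x + φ.rOut))]
    refine integral_mono hi (hc _) fun t => ?_
    have := normed_mul_nonneg φ (t := t) (y := g (x + φ.rOut) - g (x - t)) fun ht =>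
      sub_nonneg.2 (hg (by linarith [(abs_lt.1 ht).1]))
    rw [mul_sub] at this
    exact sub_nonneg.1 this
  · rw [mollify_apply, hv (g (x - φ.rOut))]
    refine integral_mono (hc _) hi fun t => ?_
    have := normed_mul_nonneg φ (t := t) (y := g (x - t) - g (x - φ.rOut)) fun ht =>
      sub_nonneg.2 (hg (by linarith [(abs_lt.1 ht).2]))
    rw [mul_sub] at this
    exact sub_nonneg.1 this

theorem conjDiagonal_sub_smul_one (U : unitaryGroup (Fin n) ℂ) (d : Fin n → ℝ) (t : ℝ) :
    conjDiagonal U d - t • (1 : Matrix (Fin n) (Fin n) ℂ) = conjDiagonal U fun i => d i - t := by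
  have : (fun i => d i - t) = d - t • (1 : Fin n → ℝ) := by
    ext i
    simp
  rw [this, map_sub, map_smul, map_one]

theorem isHermitian_sub_smul_one {A : Matrix (Fin n) (Fin n) ℂ} (hA : A.IsHermitian) (t : ℝ) :
    (A - t • (1 : Matrix (Fin n) (Fin n) ℂ)).IsHermitian := hA.sub (isHermitian_real_smul_one t)

/-- The functional calculus of a mollified function is an average of translates. -/
theorem reForm_cfc_mollify (φ : ContDiffBump (0 : ℝ)) {g : ℝ → ℝ} (hg : LocallyIntegrable g)
    {A : Matrix (Fin n) (Fin n) ℂ} (hA : A.IsHermitian) (w : Fin n → ℂ) :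
    Integrable (fun t => φ.normed volume t * reForm (cfc g (A - t • (1 : Matrix (Fin n) (Fin n) ℂ))) w) ∧
    reForm (cfc (mollify φ g) A) w =
      ∫ t, φ.normed volume t * reForm (cfc g (A - t • (1 : Matrix (Fin n) (Fin n) ℂ))) w := by
  obtain ⟨U, d, rfl⟩ := exists_conjDiagonal hA
  simp only [conjDiagonal_sub_smul_one, cfc_conjDiagonal, reForm_conjDiagonal, Finset.mul_sum,
    Function.comp_apply, ← mul_assoc]
  have hi : ∀ i, Integrable fun t => φ.normed volume t * g (d i - t) *
      ‖(star (U : Matrix (Fin n) (Fin n) ℂ) *ᵥ w) i‖ ^ 2 := fun i =>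
    (integrable_mollify φ hg (d i)).mul_const _
  refine ⟨integrable_finsetSum _ fun i _ => hi i, ?_⟩
  rw [integral_finsetSum _ fun i _ => hi i]
  refine Finset.sum_congr rfl fun i _ => ?_
  rw [integral_mul_const, mollify_apply]

theorem spectrum_sub_smul_one_subset {A : Matrix (Fin n) (Fin n) ℂ} (hA : A.IsHermitian) {l u ε t : ℝ}
    (h : spectrum ℝ A ⊆ Set.Ioo (l + ε) (u - ε)) (ht : |t| < ε) :
    spectrum ℝ (A - t • (1 : Matrix (Fin n) (Fin n) ℂ)) ⊆ Set.Ioo l u := by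
  obtain ⟨U, d, rfl⟩ := exists_conjDiagonal hA
  rw [conjDiagonal_sub_smul_one, spectrum_conjDiagonal]
  rw [spectrum_conjDiagonal] at h
  rintro _ ⟨i, rfl⟩
  have h1 := h ⟨i, rfl⟩
  have h2 := abs_lt.1 ht
  constructor <;> linarith [h1.1, h1.2]

/-- Translating both matrices by the same multiple of the identity preserves their order, so f(A -
t) ≤ f(B - t) can be averaged against the bump. Shrinking the interval by the radius keeps the
translated spectra inside. -/
theorem isMatrixMonotoneOn_mollify {g : ℝ → ℝ} (hg : LocallyIntegrable g) (φ : ContDiffBump (0 : ℝ))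
    {l u : ℝ} (h : IsMatrixMonotoneOn n (Set.Ioo l u) g) :
    IsMatrixMonotoneOn n (Set.Ioo (l + φ.rOut) (u - φ.rOut)) (mollify φ g) := by
  refine isMatrixMonotoneOn_of_reForm_le fun A B hA hB hAs hBs hAB w => ?_
  obtain ⟨iA, eA⟩ := reForm_cfc_mollify φ hg hA w
  obtain ⟨iB, eB⟩ := reForm_cfc_mollify φ hg hB w
  rw [eA, eB]
  refine integral_mono iA iB fun t => sub_nonneg.1 ?_
  rw [← mul_sub]
  refine normed_mul_nonneg φ fun ht => sub_nonneg.2 ?_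
  refine monotone_reForm_le h (isHermitian_sub_smul_one hA t) (isHermitian_sub_smul_one hB t)
    (spectrum_sub_smul_one_subset hA hAs ht) (spectrum_sub_smul_one_subset hB hBs ht) ?_ w
  rwa [sub_sub_sub_cancel_right]

theorem isMatrixConvexOn_mollify {g : ℝ → ℝ} (hg : LocallyIntegrable g) (φ : ContDiffBump (0 : ℝ))
    {l u : ℝ} (h : IsMatrixConvexOn n (Set.Ioo l u) g) :
    IsMatrixConvexOn n (Set.Ioo (l + φ.rOut) (u - φ.rOut)) (mollify φ g) := by
  refine isMatrixConvexOn_of_reForm_le fun A B hA hB hAs hBs s h0 h1 w => ?_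
  obtain ⟨iA, eA⟩ := reForm_cfc_mollify φ hg hA w
  obtain ⟨iB, eB⟩ := reForm_cfc_mollify φ hg hB w
  obtain ⟨iC, eC⟩ := reForm_cfc_mollify φ hg
    ((isHermitian_real_smul hA s).add (isHermitian_real_smul hB (1 - s))) w
  rw [eA, eB, eC, ← integral_const_mul, ← integral_const_mul,
    ← integral_add (iA.const_mul _) (iB.const_mul _)]
  refine integral_mono iC ((iA.const_mul _).add (iB.const_mul _)) fun t => sub_nonneg.1 ?_
  have key := normed_mul_nonneg φ (t := t) (y := s * reForm (cfc g (A - t • (1 : Matrix (Fin n) (Fin n) ℂ))) w +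
      (1 - s) * reForm (cfc g (B - t • (1 : Matrix (Fin n) (Fin n) ℂ))) w -
      reForm (cfc g (s • A + (1 - s) • B - t • (1 : Matrix (Fin n) (Fin n) ℂ))) w) fun ht => by
    have := convex_reForm_le h (isHermitian_sub_smul_one hA t) (isHermitian_sub_smul_one hB t)
      (spectrum_sub_smul_one_subset hA hAs ht) (spectrum_sub_smul_one_subset hB hBs ht) h0 h1 w
    have e : s • (A - t • (1 : Matrix (Fin n) (Fin n) ℂ)) + (1 - s) • (B - t • (1 : Matrix (Fin n) (Fin n) ℂ)) =
        s • A + (1 - s) • B - t • (1 : Matrix (Fin n) (Fin n) ℂ) := by module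
    rw [e] at this
    exact sub_nonneg.2 this
  refine key.trans (le_of_eq ?_)
  ring

/-- A sequence of bumps shrinking to the origin. -/
noncomputable def shrinkingBump (k : ℕ) : ContDiffBump (0 : ℝ) where
  rIn := 1 / ((k : ℝ) + 1) / 2
  rOut := 1 / ((k : ℝ) + 1)
  rIn_pos := by positivity
  rIn_lt_rOut := half_lt_self (by positivity)

theorem tendsto_rOut_shrinkingBump : Tendsto (fun k => (shrinkingBump k).rOut) atTop (𝓝 0) :=
  tendsto_one_div_add_atTop_nhds_zero_nat

theorem tendsto_reForm_cfc_mollify {g : ℝ → ℝ} (hg : Continuous g) {A : Matrix (Fin n) (Fin n) ℂ}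
    (hA : A.IsHermitian) (w : Fin n → ℂ) :
    Tendsto (fun k => reForm (cfc (mollify (shrinkingBump k) g) A) w) atTop
      (𝓝 (reForm (cfc g A) w)) := by
  obtain ⟨U, d, rfl⟩ := exists_conjDiagonal hA
  simp only [cfc_conjDiagonal, reForm_conjDiagonal]
  refine tendsto_finsetSum _ fun i _ => Tendsto.mul_const _ ?_
  exact ContDiffBump.convolution_tendsto_right_of_continuous tendsto_rOut_shrinkingBump hg (d i)

theorem eventually_spectrum_subset {A : Matrix (Fin n) (Fin n) ℂ} (hA : A.IsHermitian) {l u : ℝ}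
    (h : spectrum ℝ A ⊆ Set.Ioo l u) : ∀ᶠ k in atTop,
      spectrum ℝ A ⊆ Set.Ioo (l + (shrinkingBump k).rOut) (u - (shrinkingBump k).rOut) := by
  obtain ⟨U, d, rfl⟩ := exists_conjDiagonal hA
  rw [spectrum_conjDiagonal] at h ⊢
  have : ∀ᶠ k in atTop, ∀ i, l + (shrinkingBump k).rOut < d i ∧ d i < u - (shrinkingBump k).rOut := by
    rw [eventually_all]
    intro i
    have h1 := h ⟨i, rfl⟩
    have h2 := tendsto_rOut_shrinkingBump.eventually_lt_const (sub_pos.2 h1.1)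
    have h3 := tendsto_rOut_shrinkingBump.eventually_lt_const (sub_pos.2 h1.2)
    filter_upwards [h2, h3] with k h2 h3
    constructor <;> linarith
  filter_upwards [this] with k hk
  rintro _ ⟨i, rfl⟩
  exact hk i

/-- The mollified functions are smooth, so their local conditions on the two shrunken intervals
combine; continuity of `g` then recovers the inequality for `g` in the limit. -/
theorem IsMatrixMonotoneOn.glue_of_continuous (hn : 1 ≤ n) {g : ℝ → ℝ} (hg : Continuous g)
    {a b c d : ℝ} (hcb : c < b) (h1 : IsMatrixMonotoneOn n (Set.Ioo a b) g)
    (h2 : IsMatrixMonotoneOn n (Set.Ioo c d) g) : IsMatrixMonotoneOn n (Set.Ioo a d) g := by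
  refine isMatrixMonotoneOn_of_reForm_le fun A B hA hB hAs hBs hAB w => ?_
  refine le_of_tendsto_of_tendsto (tendsto_reForm_cfc_mollify hg hA w)
    (tendsto_reForm_cfc_mollify hg hB w) ?_
  filter_upwards [eventually_spectrum_subset hA hAs, eventually_spectrum_subset hB hBs,
    tendsto_rOut_shrinkingBump.eventually_lt_const (half_pos (sub_pos.2 hcb))] with k hkA hkB hk
  have hs := contDiff_mollify (shrinkingBump k) hg.locallyIntegrable
  have m1 := (isMatrixMonotoneOn_iff_squareDerivNonneg hn hs).1
    (isMatrixMonotoneOn_mollify hg.locallyIntegrable (shrinkingBump k) h1)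
  have m2 := (isMatrixMonotoneOn_iff_squareDerivNonneg hn hs).1
    (isMatrixMonotoneOn_mollify hg.locallyIntegrable (shrinkingBump k) h2)
  refine monotone_reForm_le ((isMatrixMonotoneOn_iff_squareDerivNonneg hn hs).2 fun x hx => ?_)
    hA hB hkA hkB hAB w
  -- The radius is below (b - c) / 2, so the shrunken intervals still overlap and cover the shrunken
  -- union.
  rcases lt_or_ge x (b - (shrinkingBump k).rOut) with hxb | hxb
  · exact m1 x ⟨hx.1, hxb⟩
  · exact m2 x ⟨by linarith, hx.2⟩

theorem IsMatrixConvexOn.glue_of_continuous (hn : 1 ≤ n) {g : ℝ → ℝ} (hg : Continuous g)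
    {a b c d : ℝ} (hcb : c < b) (h1 : IsMatrixConvexOn n (Set.Ioo a b) g)
    (h2 : IsMatrixConvexOn n (Set.Ioo c d) g) : IsMatrixConvexOn n (Set.Ioo a d) g := by
  refine isMatrixConvexOn_of_reForm_le fun A B hA hB hAs hBs t h0 ht w => ?_
  refine le_of_tendsto_of_tendsto (tendsto_reForm_cfc_mollify hg
      ((isHermitian_real_smul hA t).add (isHermitian_real_smul hB (1 - t))) w)
    (((tendsto_reForm_cfc_mollify hg hA w).const_mul t).add
      ((tendsto_reForm_cfc_mollify hg hB w).const_mul (1 - t))) ?_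
  filter_upwards [eventually_spectrum_subset hA hAs, eventually_spectrum_subset hB hBs,
    tendsto_rOut_shrinkingBump.eventually_lt_const (half_pos (sub_pos.2 hcb))] with k hkA hkB hk
  have hs := contDiff_mollify (shrinkingBump k) hg.locallyIntegrable
  have m1 := (isMatrixConvexOn_iff_squareDerivNonneg hn hs).1
    (isMatrixConvexOn_mollify hg.locallyIntegrable (shrinkingBump k) h1)
  have m2 := (isMatrixConvexOn_iff_squareDerivNonneg hn hs).1
    (isMatrixConvexOn_mollify hg.locallyIntegrable (shrinkingBump k) h2)
  refine convex_reForm_le ((isMatrixConvexOn_iff_squareDerivNonneg hn hs).2 fun x hx => ?_)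
    hA hB hkA hkB h0 ht w
  rcases lt_or_ge x (b - (shrinkingBump k).rOut) with hxb | hxb
  · exact m1 x ⟨hx.1, hxb⟩
  · exact m2 x ⟨by linarith, hx.2⟩

end Mollify

/-! ### Scalar consequences, and continuity of n-monotone functions for n ≥ 2 -/

section Continuity

open Filter Topology Matrix

variable {n : ℕ}

theorem reForm_scalar (x : ℝ) :
    reForm (conjDiagonal (1 : unitaryGroup (Fin n) ℂ) fun _ => x) (fun _ => 1) = n * x := by
  rw [reForm_conjDiagonal]
  simp

theorem IsMatrixMonotoneOn.monotoneOn (hn : 1 ≤ n) {S : Set ℝ} {f : ℝ → ℝ}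
    (h : IsMatrixMonotoneOn n S f) : MonotoneOn f S := by
  intro x hx y hy hxy
  have hn0 : (0 : ℝ) < n := by exact_mod_cast hn
  have hs : ∀ z ∈ S, spectrum ℝ (conjDiagonal (1 : unitaryGroup (Fin n) ℂ) fun _ => z) ⊆ S := by
    intro z hz
    rw [spectrum_conjDiagonal]
    rintro _ ⟨i, rfl⟩
    exact hz
  have h1 := monotone_reForm_le h (isHermitian_conjDiagonal 1 fun _ => x)
    (isHermitian_conjDiagonal 1 fun _ => y) (hs x hx) (hs y hy) (by
      rw [← map_sub, posSemidef_iff_reForm (isHermitian_conjDiagonal _ _)]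
      intro w
      rw [reForm_conjDiagonal]
      exact Finset.sum_nonneg fun i _ => mul_nonneg (by simpa using hxy) (by positivity)) fun _ => 1
  rw [cfc_conjDiagonal, cfc_conjDiagonal] at h1
  have h2 : (n : ℝ) * f x ≤ n * f y := by
    rw [← reForm_scalar, ← reForm_scalar]
    exact h1
  exact le_of_mul_le_mul_left h2 hn0

theorem IsMatrixConvexOn.convexOn (hn : 1 ≤ n) {S : Set ℝ} (hS : Convex ℝ S) {f : ℝ → ℝ}
    (h : IsMatrixConvexOn n S f) : ConvexOn ℝ S f := by
  refine ⟨hS, fun x hx y hy s t hs ht hst => ?_⟩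
  have hn0 : (0 : ℝ) < n := by exact_mod_cast hn
  obtain rfl : t = 1 - s := by linarith
  have hsp : ∀ z ∈ S, spectrum ℝ (conjDiagonal (1 : unitaryGroup (Fin n) ℂ) fun _ => z) ⊆ S := by
    intro z hz
    rw [spectrum_conjDiagonal]
    rintro _ ⟨i, rfl⟩
    exact hz
  have h1 := convex_reForm_le h (isHermitian_conjDiagonal 1 fun _ => x)
    (isHermitian_conjDiagonal 1 fun _ => y) (hsp x hx) (hsp y hy) hs (by linarith) fun _ => 1
  rw [← map_smul, ← map_smul, ← map_add, cfc_conjDiagonal, cfc_conjDiagonal, cfc_conjDiagonal] at h1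
  have h2 : (n : ℝ) * f (s • x + (1 - s) • y) ≤ s * (n * f x) + (1 - s) * (n * f y) := by
    rw [← reForm_scalar, ← reForm_scalar, ← reForm_scalar]
    exact h1
  refine le_of_mul_le_mul_left ?_ hn0
  simp only [smul_eq_mul] at h2 ⊢
  linarith

/-- This is nonnegativity of the 2 × 2 Loewner determinant at x and y, obtained from vectors
supported on two indices. -/
theorem dslope_sq_le_of_isMatrixMonotoneOn (hn : 2 ≤ n) {h : ℝ → ℝ} (hh : ContDiff ℝ (↑(⊤ : ℕ∞)) h)
    {l u : ℝ} (hm : IsMatrixMonotoneOn n (Set.Ioo l u) h) {x y : ℝ} (hx : x ∈ Set.Ioo l u)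
    (hy : y ∈ Set.Ioo l u) : dslope h x y ^ 2 ≤ deriv h x * deriv h y := by
  have key : ∀ p q : ℝ, 0 ≤ p ^ 2 * deriv h x + 2 * p * q * dslope h x y + q ^ 2 * deriv h y := by
    intro p q
    set i0 : Fin n := ⟨0, by omega⟩
    set i1 : Fin n := ⟨1, by omega⟩
    have h01 : i0 ≠ i1 := by simp [i0, i1]
    set γ : Fin n → ℝ := fun i => if i = i0 then x else y
    set r : Fin n → ℝ := fun i => if i = i0 then p else if i = i1 then q else 0
    have hγ : ∀ i, γ i ∈ Set.Ioo l u := by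
      intro i
      by_cases hi : i = i0 <;> simp [γ, hi, hx, hy, -Set.mem_Ioo]
    have hsum : ∀ F : Fin n → ℝ, ∑ i, r i * F i = p * F i0 + q * F i1 := by
      intro F
      rw [Finset.sum_eq_add i0 i1 h01]
      · simp [r, h01.symm]
      · intro i _ hi
        simp [r, hi.1, hi.2]
      · simp
      · simp
    have h1 := loewner_form_nonneg_of_isMatrixMonotoneOn hh hm hγ r
    simp only [mul_assoc, ← Finset.mul_sum, hsum] at h1
    have g0 : γ i0 = x := by simp [γ]
    have g1 : γ i1 = y := by simp [γ, h01.symm]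
    rw [g0, g1, dslope_same, dslope_same, dslope_symm h y x] at h1
    linarith
  have h1 := key 1 0
  have h2 := key 0 1
  have h3 := key (deriv h y) (-dslope h x y)
  have h4 := key (dslope h x y) (-deriv h x)
  have h5 := key 1 (-dslope h x y)
  have h6 := key (dslope h x y) (-1)
  have hx0 : 0 ≤ deriv h x := by linarith
  have hy0 : 0 ≤ deriv h y := by linarith
  rcases hy0.eq_or_lt with hy0 | hy0
  · rw [← hy0] at h5 ⊢
    have h7 := key 1 (-(deriv h x + 1) * dslope h x y)
    rw [← hy0] at h7
    nlinarith [sq_nonneg (dslope h x y)]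
  -- The vector (h'(y), -h[x, y]) evaluates the form to h'(y) times the determinant.
  · have : 0 ≤ deriv h y * (deriv h x * deriv h y - dslope h x y ^ 2) := by linarith
    exact sub_nonneg.1 (nonneg_of_mul_nonneg_right this hy0)

/-- The determinant inequality is applied to a mollification of `g` at mean value points on either
side of p. The increment across p is then controlled by one-sided increments, which vanish as δ → 0
even if `g` jumps. The factor 16 comes from y - x ≤ 4δ, against slopes over intervals of length δ.
-/
theorem jump_sq_le_of_isMatrixMonotoneOn (hn : 2 ≤ n) {g : ℝ → ℝ} (hg : Monotone g) {l u p δ : ℝ}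
    (hm : IsMatrixMonotoneOn n (Set.Ioo l u) g) (hδ : 0 < δ) (hl : l < p - 3 * δ) (hu : p + 3 * δ < u) :
    (g (p + δ / 2) - g (p - δ / 2)) ^ 2 ≤
      16 * ((g (p - δ / 2) - g (p - 3 * δ)) * (g (p + 3 * δ) - g (p + δ / 2))) := by
  set φ : ContDiffBump (0 : ℝ) := ⟨δ / 4, δ / 2, by positivity, by linarith⟩
  have hφ : φ.rOut = δ / 2 := rfl
  set h := mollify φ g
  have hs : ContDiff ℝ (↑(⊤ : ℕ∞)) h := contDiff_mollify φ hg.locallyIntegrable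
  have hmh : IsMatrixMonotoneOn n (Set.Ioo (l + δ / 2) (u - δ / 2)) h :=
    isMatrixMonotoneOn_mollify hg.locallyIntegrable φ hm
  have hmono := hmh.monotoneOn (by omega)
  have hb := mollify_le_of_monotone φ hg
  rw [hφ] at hb
  have hd : Differentiable ℝ h := hs.differentiable (by simp)
  obtain ⟨x, hx, hx'⟩ := exists_deriv_eq_slope h (a := p - 2 * δ) (b := p - δ) (by linarith)
    hd.continuous.continuousOn hd.differentiableOn
  obtain ⟨y, hy, hy'⟩ := exists_deriv_eq_slope h (a := p + δ) (b := p + 2 * δ) (by linarith)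
    hd.continuous.continuousOn hd.differentiableOn
  have hxI : x ∈ Set.Ioo (l + δ / 2) (u - δ / 2) := ⟨by linarith [hx.1], by linarith [hx.2]⟩
  have hyI : y ∈ Set.Ioo (l + δ / 2) (u - δ / 2) := ⟨by linarith [hy.1], by linarith [hy.2]⟩
  have hxy : 0 < y - x := by linarith [hx.2, hy.1]
  have hxy4 : y - x ≤ 4 * δ := by linarith [hx.1, hy.2]
  have hsq := dslope_sq_le_of_isMatrixMonotoneOn hn hs hmh hxI hyI
  rw [dslope_eq_div (sub_pos.1 hxy).ne, hx', hy', div_pow, div_mul_div_comm] at hsq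
  have e1 : p - δ - (p - 2 * δ) = δ := by ring
  have e2 : p + 2 * δ - (p + δ) = δ := by ring
  rw [e1, e2] at hsq
  have b1 := (hb (p - δ)).1
  have b2 := (hb (p - 2 * δ)).2
  have b3 := (hb (p + δ)).2
  have b4 := (hb (p + 2 * δ)).1
  rw [show p - δ + δ / 2 = p - δ / 2 by ring] at b1
  rw [show p + δ - δ / 2 = p + δ / 2 by ring] at b3
  have b2' : g (p - 3 * δ) ≤ h (p - 2 * δ) := (hg (by linarith)).trans b2
  have b4' : h (p + 2 * δ) ≤ g (p + 3 * δ) := b4.trans (hg (by linarith))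
  have hJ : g (p + δ / 2) - g (p - δ / 2) ≤ h y - h x := by
    have m1 : h x ≤ h (p - δ) := hmono hxI ⟨by linarith, by linarith⟩ hx.2.le
    have m2 : h (p + δ) ≤ h y := hmono ⟨by linarith, by linarith⟩ hyI hy.1.le
    linarith
  have hJ0 : 0 ≤ g (p + δ / 2) - g (p - δ / 2) := sub_nonneg.2 (hg (by linarith))
  have hP0 : 0 ≤ h (p - δ) - h (p - 2 * δ) :=
    sub_nonneg.2 (hmono ⟨by linarith, by linarith⟩ ⟨by linarith, by linarith⟩ (by linarith))
  have hQ0 : 0 ≤ h (p + 2 * δ) - h (p + δ) :=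
    sub_nonneg.2 (hmono ⟨by linarith, by linarith⟩ ⟨by linarith, by linarith⟩ (by linarith))
  have hPQ : (h (p - δ) - h (p - 2 * δ)) * (h (p + 2 * δ) - h (p + δ)) ≤
      (g (p - δ / 2) - g (p - 3 * δ)) * (g (p + 3 * δ) - g (p + δ / 2)) :=
    mul_le_mul (by linarith) (by linarith) hQ0 (by linarith)
  rw [div_le_div_iff₀ (by positivity) (by positivity)] at hsq
  have hJ2 : (g (p + δ / 2) - g (p - δ / 2)) ^ 2 ≤ (h y - h x) ^ 2 := by gcongr
  have hxy2 : (y - x) ^ 2 ≤ (4 * δ) ^ 2 := by gcongr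
  have hδ2 : 0 < δ * δ := by positivity
  have hfin : (h y - h x) ^ 2 * (δ * δ) ≤
      16 * ((h (p - δ) - h (p - 2 * δ)) * (h (p + 2 * δ) - h (p + δ))) * (δ * δ) := by
    calc _ ≤ _ := hsq
      _ ≤ (h (p - δ) - h (p - 2 * δ)) * (h (p + 2 * δ) - h (p + δ)) * (4 * δ) ^ 2 := by gcongr
      _ = _ := by ring
  have := le_of_mul_le_mul_right hfin hδ2
  linarith

/-- As δ → 0 the left side of the jump estimate tends to the squared jump, while the one-sided
increments on the right tend to 0. -/
theorem continuousAt_of_isMatrixMonotoneOn_of_monotone (hn : 2 ≤ n) {g : ℝ → ℝ} (hg : Monotone g)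
    {l u p : ℝ} (hp : p ∈ Set.Ioo l u) (hm : IsMatrixMonotoneOn n (Set.Ioo l u) g) :
    ContinuousAt g p := by
  rw [hg.continuousAt_iff_leftLim_eq_rightLim]
  have hL : ∀ k : ℝ, 0 < k → Tendsto (fun δ => g (p - k * δ)) (𝓝[>] 0) (𝓝 (Function.leftLim g p)) := by
    intro k hk
    refine (hg.tendsto_leftLim p).comp (tendsto_nhdsWithin_iff.2 ⟨?_, ?_⟩)
    · have : ContinuousAt (fun δ : ℝ => p - k * δ) 0 := by fun_prop
      have h := this.tendsto
      simp only [mul_zero, sub_zero] at h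
      exact h.mono_left nhdsWithin_le_nhds
    · filter_upwards [self_mem_nhdsWithin] with δ hδ
      have : 0 < k * δ := mul_pos hk hδ
      simpa using this
  have hR : ∀ k : ℝ, 0 < k → Tendsto (fun δ => g (p + k * δ)) (𝓝[>] 0) (𝓝 (Function.rightLim g p)) := by
    intro k hk
    refine (hg.tendsto_rightLim p).comp (tendsto_nhdsWithin_iff.2 ⟨?_, ?_⟩)
    · have : ContinuousAt (fun δ : ℝ => p + k * δ) 0 := by fun_prop
      have h := this.tendsto
      simp only [mul_zero, add_zero] at h
      exact h.mono_left nhdsWithin_le_nhds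
    · filter_upwards [self_mem_nhdsWithin] with δ hδ
      have : 0 < k * δ := mul_pos hk hδ
      simpa using this
  have hl2 := hL (1 / 2) (by norm_num)
  have hr2 := hR (1 / 2) (by norm_num)
  have hlim1 := (hr2.sub hl2).pow 2
  have hlim2 := ((hl2.sub (hL 3 (by norm_num))).mul ((hR 3 (by norm_num)).sub hr2)).const_mul 16
  have hle := le_of_tendsto_of_tendsto hlim1 hlim2 (by
    have e1 : (0 : ℝ) < (p - l) / 3 := by linarith [hp.1]
    have e2 : (0 : ℝ) < (u - p) / 3 := by linarith [hp.2]
    filter_upwards [Ioo_mem_nhdsGT e1, Ioo_mem_nhdsGT e2] with δ h1 h2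
    have := jump_sq_le_of_isMatrixMonotoneOn hn hg hm (δ := δ) (p := p) h1.1
      (by linarith [h1.2]) (by linarith [h2.2])
    have e : (1 / 2 : ℝ) * δ = δ / 2 := by ring
    rw [e]
    exact this)
  simp only [sub_self, mul_zero] at hle
  have := pow_eq_zero_iff (two_ne_zero) |>.1 (le_antisymm hle (sq_nonneg _))
  linarith

end Continuity

/-! ### Reduction to bounded intervals and the final gluing -/

section Gluing

open Filter Topology Matrix

variable {n : ℕ}

theorem IsMatrixMonotoneOn.mono {S T : Set ℝ} {f : ℝ → ℝ} (h : IsMatrixMonotoneOn n T f)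
    (hST : S ⊆ T) : IsMatrixMonotoneOn n S f :=
  fun A B hA hB hAs hBs => h A B hA hB (hAs.trans hST) (hBs.trans hST)

theorem IsMatrixConvexOn.mono {S T : Set ℝ} {f : ℝ → ℝ} (h : IsMatrixConvexOn n T f)
    (hST : S ⊆ T) : IsMatrixConvexOn n S f :=
  fun A B hA hB hAs hBs => h A B hA hB (hAs.trans hST) (hBs.trans hST)

theorem IsMatrixMonotoneOn.congr {S : Set ℝ} {f g : ℝ → ℝ} (h : IsMatrixMonotoneOn n S f)
    (hfg : Set.EqOn f g S) : IsMatrixMonotoneOn n S g := by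
  intro A B hA hB hAs hBs hAB
  rw [← cfc_congr (hfg.mono hAs), ← cfc_congr (hfg.mono hBs)]
  exact h A B hA hB hAs hBs hAB

theorem IsMatrixConvexOn.congr {l u : ℝ} {f g : ℝ → ℝ} (h : IsMatrixConvexOn n (Set.Ioo l u) f)
    (hfg : Set.EqOn f g (Set.Ioo l u)) : IsMatrixConvexOn n (Set.Ioo l u) g := by
  intro A B hA hB hAs hBs t h0 h1
  rw [← cfc_congr (hfg.mono hAs), ← cfc_congr (hfg.mono hBs),
    ← cfc_congr (hfg.mono (spectrum_convexComb_subset_Ioo hA hB hAs hBs h0 h1))]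
  exact h A B hA hB hAs hBs t h0 h1

theorem exists_Ioo_of_finite {a d : EReal} {F : Set ℝ} (hF : F.Finite) (hne : F.Nonempty)
    (h : F ⊆ openInterval a d) :
    ∃ l u : ℝ, a < (l : EReal) ∧ (u : EReal) < d ∧ F ⊆ Set.Ioo l u := by
  obtain ⟨m, hm, hm'⟩ := hF.exists_minimalFor id F hne
  obtain ⟨M, hM, hM'⟩ := hF.exists_maximalFor id F hne
  obtain ⟨l, hl1, hl2⟩ := EReal.lt_iff_exists_real_btwn.1 (h hm).1
  obtain ⟨u, hu1, hu2⟩ := EReal.lt_iff_exists_real_btwn.1 (h hM).2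
  rw [EReal.coe_lt_coe_iff] at hl2 hu1
  refine ⟨l, u, hl1, hu2, fun x hx => ⟨hl2.trans_le ?_, lt_of_le_of_lt ?_ hu1⟩⟩
  · rcases le_total m x with h | h
    · exact h
    · exact hm' hx h
  · rcases le_total x M with h | h
    · exact h
    · exact hM' hx h

theorem Icc_subset_openInterval {a d : EReal} {l u : ℝ} (hl : a < (l : EReal)) (hu : (u : EReal) < d) :
    Set.Icc l u ⊆ openInterval a d := fun _ hx =>
  ⟨hl.trans_le (EReal.coe_le_coe_iff.2 hx.1), (EReal.coe_le_coe_iff.2 hx.2).trans_lt hu⟩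

theorem isOpen_openInterval (a d : EReal) : IsOpen (openInterval a d) :=
  (isOpen_lt continuous_const continuous_coe_real_ereal).inter
    (isOpen_lt continuous_coe_real_ereal continuous_const)

theorem convex_openInterval (a d : EReal) : Convex ℝ (openInterval a d) := by
  rw [convex_iff_ordConnected]
  exact ⟨fun x hx y hy z hz => ⟨hx.1.trans_le (EReal.coe_le_coe_iff.2 hz.1),
    (EReal.coe_le_coe_iff.2 hz.2).trans_lt hy.2⟩⟩

/-- Extending `f` by constants outside a compact interval gives a function on the whole line to
which mollification applies. -/
theorem iccExtend_eqOn {l u : ℝ} (h : l ≤ u) (f : ℝ → ℝ) :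
    Set.EqOn f (Set.IccExtend h fun x : Set.Icc l u => f x) (Set.Icc l u) := by
  intro x hx
  rw [Set.IccExtend_of_mem h _ hx]

theorem IsMatrixMonotoneOn.continuousOn (hn : 2 ≤ n) {a b : EReal} {f : ℝ → ℝ}
    (h : IsMatrixMonotoneOn n (openInterval a b) f) : ContinuousOn f (openInterval a b) := by
  intro p hp
  obtain ⟨l, u, hl, hu, hpI⟩ := exists_Ioo_of_finite (Set.finite_singleton p)
    (Set.singleton_nonempty p) (Set.singleton_subset_iff.2 hp)
  rw [Set.singleton_subset_iff] at hpI
  have hlu : l ≤ u := (hpI.1.trans hpI.2).le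
  have hsub := Icc_subset_openInterval hl hu
  have hmono := (h.monotoneOn (by omega)).mono hsub
  have heq := iccExtend_eqOn hlu f
  have hg : Monotone (Set.IccExtend hlu fun x : Set.Icc l u => f x) :=
    Monotone.IccExtend hlu fun x y hxy => hmono x.2 y.2 hxy
  have hc := continuousAt_of_isMatrixMonotoneOn_of_monotone hn hg hpI
    ((h.mono (Set.Ioo_subset_Icc_self.trans hsub)).congr (heq.mono Set.Ioo_subset_Icc_self))
  refine (hc.congr ?_).continuousWithinAt
  filter_upwards [Ioo_mem_nhds hpI.1 hpI.2] with x hx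
  exact (heq (Set.Ioo_subset_Icc_self hx)).symm

theorem openInterval_subset_union {a b c d : EReal} (hcb : c < b) :
    openInterval a d ⊆ openInterval a b ∪ openInterval c d := by
  intro x hx
  rcases lt_or_ge (x : EReal) b with h | h
  · exact Or.inl ⟨hx.1, h⟩
  · exact Or.inr ⟨hcb.trans_le h, hx.2⟩

theorem continuousOn_openInterval_glue {a b c d : EReal} (hcb : c < b) {f : ℝ → ℝ}
    (h1 : ContinuousOn f (openInterval a b)) (h2 : ContinuousOn f (openInterval c d)) :
    ContinuousOn f (openInterval a d) :=
  (h1.union_of_isOpen h2 (isOpen_openInterval a b) (isOpen_openInterval c d)).mono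
    (openInterval_subset_union hcb)

/-- Reduction of gluing on extended intervals to real intervals containing given finite spectra. -/
theorem exists_real_intervals {a b c d : EReal} (hac : a < c) (hcb : c < b) (hbd : b < d)
    {A B : Matrix (Fin n) (Fin n) ℂ} (hAs : spectrum ℝ A ⊆ openInterval a d)
    (hBs : spectrum ℝ B ⊆ openInterval a d) :
    ∃ l c' b' u : ℝ, c' < b' ∧ l ≤ u ∧ Set.Icc l u ⊆ openInterval a d ∧
      Set.Ioo l b' ⊆ openInterval a b ∩ Set.Icc l u ∧ Set.Ioo c' u ⊆ openInterval c d ∩ Set.Icc l u ∧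
      spectrum ℝ A ⊆ Set.Ioo l u ∧ spectrum ℝ B ⊆ Set.Ioo l u := by
  -- Real points c < c' < b' < b keep an overlap. Including both in the finite set below places them
  -- inside the bounded interval along with the spectra.
  obtain ⟨c', hc1, hc2⟩ := EReal.lt_iff_exists_real_btwn.1 hcb
  obtain ⟨b', hb1, hb2⟩ := EReal.lt_iff_exists_real_btwn.1 hc2
  rw [EReal.coe_lt_coe_iff] at hb1
  obtain ⟨l, u, hl, hu, hF⟩ := exists_Ioo_of_finite (a := a) (d := d)
    (F := {c', b'} ∪ (spectrum ℝ A ∪ spectrum ℝ B))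
    ((Set.toFinite _).union (A.finite_real_spectrum.union B.finite_real_spectrum))
    ⟨c', Or.inl (Or.inl rfl)⟩ (by
      refine Set.union_subset ?_ (Set.union_subset hAs hBs)
      rintro x (rfl | rfl)
      · exact ⟨hac.trans hc1, hc2.trans hbd⟩
      · exact ⟨hac.trans (hc1.trans (EReal.coe_lt_coe_iff.2 hb1)), hb2.trans hbd⟩)
  have hc' : c' ∈ Set.Ioo l u := hF (Or.inl (Or.inl rfl))
  have hb' : b' ∈ Set.Ioo l u := hF (Or.inl (Or.inr rfl))
  refine ⟨l, c', b', u, hb1, (hc'.1.trans hc'.2).le, Icc_subset_openInterval hl hu, ?_, ?_,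
    fun x hx => hF (Or.inr (Or.inl hx)), fun x hx => hF (Or.inr (Or.inr hx))⟩
  · exact fun x hx => ⟨⟨hl.trans (EReal.coe_lt_coe_iff.2 hx.1), (EReal.coe_lt_coe_iff.2 hx.2).trans hb2⟩,
      hx.1.le, (hx.2.trans hb'.2).le⟩
  · exact fun x hx => ⟨⟨hc1.trans (EReal.coe_lt_coe_iff.2 hx.1), (EReal.coe_lt_coe_iff.2 hx.2).trans hu⟩,
      (hc'.1.trans hx.1).le, hx.2.le⟩

/-- A 1 × 1 Hermitian matrix is a real scalar. Order 1 needs its own argument because a monotone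
function may be discontinuous. -/
theorem isMatrixMonotoneOn_one_of_monotoneOn {S : Set ℝ} {f : ℝ → ℝ} (h : MonotoneOn f S) :
    IsMatrixMonotoneOn 1 S f := by
  have key : ∀ A : Matrix (Fin 1) (Fin 1) ℂ, A.IsHermitian →
      ∃ x : ℝ, A = conjDiagonal 1 fun _ => x := by
    intro A hA
    obtain ⟨U, d, rfl⟩ := exists_conjDiagonal hA
    refine ⟨d 0, ?_⟩
    have hd : d = algebraMap ℝ (Fin 1 → ℝ) (d 0) := by
      ext i
      rw [Subsingleton.elim i 0]
      simp
    have h1 : (fun _ : Fin 1 => d 0) = algebraMap ℝ (Fin 1 → ℝ) (d 0) := rfl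
    rw [h1, AlgHom.commutes]
    conv_lhs => rw [hd, AlgHom.commutes]
  refine isMatrixMonotoneOn_of_reForm_le fun A B hA hB hAs hBs hAB w => ?_
  obtain ⟨x, rfl⟩ := key A hA
  obtain ⟨y, rfl⟩ := key B hB
  rw [spectrum_conjDiagonal, Set.range_const, Set.singleton_subset_iff] at hAs hBs
  have hxy : x ≤ y := by
    have := (posSemidef_iff_reForm hAB.1).1 hAB fun _ => 1
    rw [reForm_sub, reForm_scalar, reForm_scalar] at this
    simpa using this
  rw [cfc_conjDiagonal, cfc_conjDiagonal, reForm_conjDiagonal, reForm_conjDiagonal]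
  exact Finset.sum_le_sum fun i _ => mul_le_mul_of_nonneg_right (h hAs hBs hxy) (by positivity)

theorem monotoneOn_openInterval_glue {a b c d : EReal} (hac : a < c) (hcb : c < b) (hbd : b < d)
    {f : ℝ → ℝ} (h1 : MonotoneOn f (openInterval a b)) (h2 : MonotoneOn f (openInterval c d)) :
    MonotoneOn f (openInterval a d) := by
  intro x hx y hy hxy
  have hxy' : (x : EReal) ≤ y := EReal.coe_le_coe_iff.2 hxy
  by_cases hyb : (y : EReal) < b
  · exact h1 ⟨hx.1, hxy'.trans_lt hyb⟩ ⟨hy.1, hyb⟩ hxy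
  by_cases hxc : c < (x : EReal)
  · exact h2 ⟨hxc, hx.2⟩ ⟨hxc.trans_le hxy', hy.2⟩ hxy
  push Not at hyb hxc
  -- Here x ≤ c and y ≥ b, so the comparison passes through a point of the overlap.
  obtain ⟨m, hm1, hm2⟩ := EReal.lt_iff_exists_real_btwn.1 hcb
  have hxm : (x : EReal) < m := hxc.trans_lt hm1
  have hmy : (m : EReal) < y := hm2.trans_le hyb
  exact (h1 ⟨hx.1, hxm.trans hm2⟩ ⟨hac.trans hm1, hm2⟩ (EReal.coe_lt_coe_iff.1 hxm).le).trans
    (h2 ⟨hm1, hm2.trans hbd⟩ ⟨hm1.trans hmy, hy.2⟩ (EReal.coe_lt_coe_iff.1 hmy).le)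

theorem IsMatrixMonotoneOn.glue (hn : 1 ≤ n) {a b c d : EReal} (hac : a < c) (hcb : c < b)
    (hbd : b < d) {f : ℝ → ℝ} (h1 : IsMatrixMonotoneOn n (openInterval a b) f)
    (h2 : IsMatrixMonotoneOn n (openInterval c d) f) :
    IsMatrixMonotoneOn n (openInterval a d) f := by
  rcases hn.eq_or_lt with rfl | hn2
  · exact isMatrixMonotoneOn_one_of_monotoneOn
      (monotoneOn_openInterval_glue hac hcb hbd (h1.monotoneOn le_rfl) (h2.monotoneOn le_rfl))
  intro A B hA hB hAs hBs
  obtain ⟨l, c', b', u, hcb', hlu, hI, hlb, hcu, hAI, hBI⟩ :=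
    exists_real_intervals hac hcb hbd hAs hBs
  have hc := (continuousOn_openInterval_glue hcb (h1.continuousOn hn2) (h2.continuousOn hn2)).mono hI
  have heq := iccExtend_eqOn hlu f
  have hg : Continuous (Set.IccExtend hlu fun x : Set.Icc l u => f x) :=
    (continuousOn_iff_continuous_domRestrict.1 hc).Icc_extend'
  have := IsMatrixMonotoneOn.glue_of_continuous hn hg hcb'
    ((h1.mono fun x hx => (hlb hx).1).congr (heq.mono fun x hx => (hlb hx).2))
    ((h2.mono fun x hx => (hcu hx).1).congr (heq.mono fun x hx => (hcu hx).2))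
  exact this.congr (heq.symm.mono Set.Ioo_subset_Icc_self) A B hA hB hAI hBI

theorem IsMatrixConvexOn.glue (hn : 1 ≤ n) {a b c d : EReal} (hac : a < c) (hcb : c < b)
    (hbd : b < d) {f : ℝ → ℝ} (h1 : IsMatrixConvexOn n (openInterval a b) f)
    (h2 : IsMatrixConvexOn n (openInterval c d) f) :
    IsMatrixConvexOn n (openInterval a d) f := by
  intro A B hA hB hAs hBs
  obtain ⟨l, c', b', u, hcb', hlu, hI, hlb, hcu, hAI, hBI⟩ :=
    exists_real_intervals hac hcb hbd hAs hBs
  -- Scalar convexity on an open interval already gives continuity, so order 1 needs no separate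
  -- case.
  have hc := (continuousOn_openInterval_glue hcb
    ((h1.convexOn hn (convex_openInterval a b)).continuousOn (isOpen_openInterval a b))
    ((h2.convexOn hn (convex_openInterval c d)).continuousOn (isOpen_openInterval c d))).mono hI
  have heq := iccExtend_eqOn hlu f
  have hg : Continuous (Set.IccExtend hlu fun x : Set.Icc l u => f x) :=
    (continuousOn_iff_continuous_domRestrict.1 hc).Icc_extend'
  have := IsMatrixConvexOn.glue_of_continuous hn hg hcb'
    ((h1.mono fun x hx => (hlb hx).1).congr (heq.mono fun x hx => (hlb hx).2))
    ((h2.mono fun x hx => (hcu hx).1).congr (heq.mono fun x hx => (hcu hx).2))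
  exact this.congr (heq.symm.mono Set.Ioo_subset_Icc_self) A B hA hB hAI hBI

end Gluing

theorem corollary1p5 (n : ℕ) (hn : 1 ≤ n) (a b c d : EReal) (hac : a < c) (hcb : c < b)
    (hbd : b < d) (f : ℝ → ℝ) :
    (IsMatrixMonotoneOn n (openInterval a b) f → IsMatrixMonotoneOn n (openInterval c d) f →
      IsMatrixMonotoneOn n (openInterval a d) f) ∧
    (IsMatrixConvexOn n (openInterval a b) f → IsMatrixConvexOn n (openInterval c d) f →
      IsMatrixConvexOn n (openInterval a d) f) :=
  ⟨fun h1 h2 => h1.glue hn hac hcb hbd h2, fun h1 h2 => h1.glue hn hac hcb hbd h2⟩
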